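/- **Setting.** For a measurable space $E$ write $\mathcal P(E)$ for its probability measures, $\mathcal B(E)$ for the bounded measurable real functions with $\|f\|=\sup|f|$, $\mathrm{Osc}_1(E)$ for the measurable $f$ with $\sup_{x,y}|f(x)-f(y)|\le 1$, $\|\mu-\nu\|=\sup_{\|f\|\le1}|\mu(f)-\nu(f)|$ for the total variation norm, $\|M-M'\|=\sup_x\|M(x,\cdot)-M'(x,\cdot)\|$ for Markov transitions, and $\beta(M)=\sup_{f\in \mathrm{Osc}_1}\sup_{x,y}|M(f)(x)-M(f)(y)|$ for the Dobrushin coefficient. Let $(S^{(l)})_{l\ge0}$ be measurable spaces, $\Phi_l:\mathcal P(S^{(l-1)})\to\mathcal P(S^{(l)})$ ($l\ge1$) mappings, $\pi^{(0)}\in\mathcal P(S^{(0)})$ and $\pi^{(l)}=\Phi_l(\pi^{(l-1)})$. Let $M^{(0)}$ be a Markov transition on $S^{(0)}$ with invariant measure $\pi^{(0)}$ and, for $l\ge1$ and $\mu\in\mathcal P(S^{(l-1)})$, let $M^{(l)}_\mu$ be a Markov transition on $S^{(l)}$, depending measurably on $\mu$, with invariant measure $\Phi_l(\mu)$. Let $X^{(0)}$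 be a Markov chain with initial law $\nu_0$ and transition $M^{(0)}$; for $l\ge1$, given the chain $X^{(l-1)}$, let $X^{(l)}$ be a Markov chain with initial law $\nu_l$ and transition $M^{(l)}_{\eta^{(l-1)}_n}$ from time $n$ to time $n+1$, where $\eta^{(l)}_n=\frac1{n+1}\sum_{p=0}^n\delta_{X^{(l)}_p}$. **Regularity.** Suppose that for each $l\ge1$ and $f\in\mathcal B(S^{(l)})$ there is a measure $\Gamma_l(f,dg)$ on $\mathcal B(S^{(l-1)})$ (the image of a measure under a family $i\mapsto g_i$ for which $(i,x)\mapsto g_i(x)$ and $i\mapsto\|g_i\|$ are measurable) with $$|[\Phi_l(\mu)-\Phi_l(\nu)](f)|\le\int|[\mu-\nu](g)|\,\Gamma_l(f,dg)\quad\text{for all }\mu,\nu,\qquad \int\|g\|\,\Gamma_l(f,dg)\le\Lambda_l\|f\|,$$ with $0\le\Lambda_l<\infty$, and that for some integers $n_l\ge0$ and constants $c_l\ge0$ $$\|M^{(l)}_\mu-M^{(l)}_\nu\|\le c_l\|\mu-\nu\|,\qquad b_l:=\sup_\mu\beta\big((M^{(l)}_\mu)^{n_l}\big)<1 \qquad(l\ge0),$$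 where for $l=0$ the transition is $M^{(0)}$ and only the second condition is relevant. **Exponential stability.** For flows $\eta=(\eta_n)_{n\ge0}\in\mathcal P(S^{(l-1)})^{\mathbb N}$ put $\overline\Phi{}^{(l)}(\eta)_n=\frac1{n+1}\sum_{p=0}^n\Phi_l(\eta_p)$, let $\overline\Phi{}^{(l+k,l+1)}=\overline\Phi{}^{(l+k)}\circ\cdots\circ\overline\Phi{}^{(l+1)}$ (the identity for $k=0$) and $\|\eta-\mu\|=\sup_n\|\eta_n-\mu_n\|$ for flows. Suppose that there are $\lambda_1,\lambda_2>0$ and an integer $k_0\ge0$ such that for all $l\ge0$, all $\eta,\mu\in\mathcal P(S^{(l)})^{\mathbb N}$ and all $k\ge k_0$ $$\|\overline\Phi{}^{(l+k,l+1)}(\eta)-\overline\Phi{}^{(l+k,l+1)}(\mu)\|\le\lambda_1e^{-\lambda_2k}.$$ Suppose also that $$A:=\sup_{k\ge0}(1+c_k)\Big(\frac{n_k}{1-b_k}\Big)^2<\infty,\qquad B:=2\sup_{k\ge1}\Lambda_k<\infty.$$ **Theorem.** There are finite constants $e(r)$, $r\ge1$, depending only on $r$, such that in the above situation, for every real $r\ge1$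 and every $(f_l)_{l\ge0}\in\prod_{l\ge0}\mathrm{Osc}_1(S^{(l)})$: * if $B=1$, then for every $n$ with $n+1\ge e^{2\lambda_2(k_0+1)}$ $$\sup_{l\ge0}\mathbb E\big(|[\eta^{(l)}_n-\pi^{(l)}](f_l)|^r\big)^{1/r}\le\frac{e(r)}{\sqrt{n+1}}\Big(A\Big(1+\frac{\log(n+1)}{2\lambda_2}\Big)+\lambda_1e^{\lambda_2}\Big);$$ * if $B>1$, then for every $n$ with $n+1\ge e^{2(\lambda_2+\log B)(k_0+1)}$ $$\sup_{l\ge0}\mathbb E\big(|[\eta^{(l)}_n-\pi^{(l)}](f_l)|^r\big)^{1/r}\le e(r)\Big[\frac{AB}{B-1}+\lambda_1\Big]\frac{e^{\lambda_2}}{(n+1)^{\alpha/2}},\qquad\alpha=\frac{\lambda_2}{\lambda_2+\log B}.$$ -/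

import Mathlib

open MeasureTheory ProbabilityTheory
open scoped ENNReal NNReal

universe u v w

noncomputable section

namespace IMCMC

/-! ### Bounded functions, oscillations, total variation, Dobrushin coefficient -/

section Norms

variable {E : Type u} [MeasurableSpace E]

/-- The space of bounded measurable real functions on `E`. -/
def BddMeas (E : Type u) [MeasurableSpace E] : Type u :=
  {f : E → ℝ // Measurable f ∧ ∃ C : ℝ, ∀ x, |f x| ≤ C}

/-- Measurable functions bounded by one: the unit ball of `BddMeas E`. -/
def UnitBall (E : Type u) [MeasurableSpace E] : Type u :=
  {f : E → ℝ // Measurable f ∧ ∀ x, |f x| ≤ 1}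

/-- Measurable functions with oscillation at most one. -/
def Osc1 (E : Type u) [MeasurableSpace E] : Type u :=
  {f : E → ℝ // Measurable f ∧ ∀ x y, |f x - f y| ≤ 1}

/-- The uniform norm of a bounded function. -/
def supNorm (f : E → ℝ) : ℝ := ⨆ x, |f x|

/-- The oscillation of a bounded function. -/
def osc (f : E → ℝ) : ℝ := ⨆ p : E × E, |f p.1 - f p.2|

/-- `[μ - ν](f)`, the integral of `f` against the difference of two measures. -/
def diffInt (μ ν : Measure E) (f : E → ℝ) : ℝ := (∫ x, f x ∂μ) - ∫ x, f x ∂ν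

/-- The total variation norm of `μ - ν`, as the supremum of `|[μ - ν](f)|` over `‖f‖ ≤ 1`
(so that two distinct Dirac masses are at distance `2`). -/
def tvDist (μ ν : Measure E) : ℝ := ⨆ f : UnitBall E, |diffInt μ ν f.1|

/-- The operator norm of the difference of two Markov transitions. -/
def kernelDist (K L : Kernel E E) : ℝ := ⨆ x, tvDist (K x) (L x)

/-- The Dobrushin coefficient: the supremum of the oscillations of `K(f)` over the functions `f`
with oscillation at most one. -/
def dobrushin (K : Kernel E E) : ℝ := ⨆ f : Osc1 E, osc (fun x => ∫ y, f.1 y ∂(K x))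

end Norms

/-! ### Time averages of flows of probability measures -/

section Flows

variable {E : Type u} [MeasurableSpace E]

/-- The average `(n+1)⁻¹ ∑_{p ≤ n} η_p` of a flow of probability measures. -/
def average (η : ℕ → ProbabilityMeasure E) (n : ℕ) : ProbabilityMeasure E :=
  ⟨((n : ℝ≥0∞) + 1)⁻¹ • ∑ p ∈ Finset.range (n + 1), (η p : Measure E), by
    constructor
    simp only [Measure.smul_apply, Measure.finsetSum_apply, measure_univ, Finset.sum_const,
      Finset.card_range, nsmul_eq_mul, mul_one, smul_eq_mul, Nat.cast_add, Nat.cast_one]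
    exact ENNReal.inv_mul_cancel (by simp) (by simp)⟩

/-- The occupation measure `(n+1)⁻¹ ∑_{p ≤ n} δ_{x_p}` of a sequence of points. -/
def occupation (x : ℕ → E) (n : ℕ) : ProbabilityMeasure E :=
  average (fun p => diracProba (x p)) n

/-- The uniform total variation distance between two flows of probability measures. -/
def flowDist (η μ : ℕ → ProbabilityMeasure E) : ℝ :=
  ⨆ n, tvDist (η n : Measure E) (μ n : Measure E)

end Flows

/-! ### Measures on the space of bounded measurable functions -/

/-- A measure `Γ(dg)` on the space of bounded measurable functions on `E`, given as the image of
the measure `law` under `i ↦ fn i`. Joint measurability of `(i, x) ↦ fn i x` and measurability of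
`i ↦ ‖fn i‖` are what is needed for `∫ |[μ - ν](g)| Γ(dg)`, also with random `μ` and `ν`, and
`∫ ‖g‖ Γ(dg)` to be meaningful. -/
structure FunMeasure (E : Type u) [MeasurableSpace E] where
  /-- the set of functions on which the measure is carried -/
  Index : Type w
  [mIndex : MeasurableSpace Index]
  law : Measure Index
  fn : Index → E → ℝ
  measurable_fn : Measurable (Function.uncurry fn)
  bounded_fn : ∀ i, ∃ C : ℝ, ∀ x, |fn i x| ≤ C
  measurable_norm : AEMeasurable (fun i => supNorm (fn i)) law

attribute [instance] FunMeasure.mIndex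

/-- `∫ F(g) Γ(dg)` for a nonnegative function `F`. -/
def FunMeasure.lint {E : Type u} [MeasurableSpace E] (Γ : FunMeasure.{u, w} E)
    (F : (E → ℝ) → ℝ) : ℝ≥0∞ :=
  ∫⁻ i, ENNReal.ofReal (F (Γ.fn i)) ∂Γ.law

/-! ### The model -/

/-- The data of an interacting Markov chain Monte Carlo model on the state spaces `S l`:
the mappings `Φ_{l+1}`, the measure `π^{(0)}`, and Markov transitions `M^{(0)}`, `M_μ^{(l+1)}`
(measurable in the pair formed by `μ` and the current state) with invariant measures `π^{(0)}`
and `Φ_{l+1}(μ)`, and the initial distributions `ν_l`. -/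
structure Model (S : ℕ → Type u) [∀ l, MeasurableSpace (S l)] where
  /-- `Φ l` is the mapping `Φ_{l+1}` from probability measures on level `l` to level `l + 1`. -/
  Φ : ∀ l, ProbabilityMeasure (S l) → ProbabilityMeasure (S (l + 1))
  π₀ : ProbabilityMeasure (S 0)
  M₀ : Kernel (S 0) (S 0)
  /-- `M l (μ, x)` is the transition `M_μ^{(l+1)}(x, ·)`. -/
  M : ∀ l, Kernel (ProbabilityMeasure (S l) × S (l + 1)) (S (l + 1))
  ν : ∀ l, ProbabilityMeasure (S l)
  markov₀ : IsMarkovKernel M₀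
  markov : ∀ l, IsMarkovKernel (M l)
  invariant₀ : M₀.Invariant (π₀ : Measure (S 0))
  invariant : ∀ l μ, ((M l).sectR μ).Invariant (Φ l μ : Measure (S (l + 1)))

namespace Model

variable {S : ℕ → Type u} [∀ l, MeasurableSpace (S l)] (𝓜 : Model S)

/-- The target measures: `π^{(l+1)} = Φ_{l+1}(π^{(l)})`. -/
def target : ∀ l, ProbabilityMeasure (S l)
  | 0 => 𝓜.π₀
  | l + 1 => 𝓜.Φ l (target l)

/-- `b_l(n) = sup_μ β((M_μ^{(l)})^n)`. -/
def b : ℕ → ℕ → ℝ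
  | 0, n => dobrushin (𝓜.M₀ ^ n)
  | l + 1, n => ⨆ μ : ProbabilityMeasure (S l), dobrushin (((𝓜.M l).sectR μ) ^ n)

/-- The time averaged transformation: `Φbar l η` is the flow
`n ↦ (n+1)⁻¹ ∑_{p ≤ n} Φ_{l+1}(η_p)`. -/
def Φbar (l : ℕ) (η : ℕ → ProbabilityMeasure (S l)) : ℕ → ProbabilityMeasure (S (l + 1)) :=
  average (fun p => 𝓜.Φ l (η p))

/-- The time averaged semigroup from level `l` to level `l + k`: the composition of the time
averaged transformations of levels `l + 1, …, l + k`, the identity for `k = 0`. -/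
def semigroup (l : ℕ) : ∀ k,
    (ℕ → ProbabilityMeasure (S l)) → (ℕ → ProbabilityMeasure (S (l + k)))
  | 0, η => η
  | k + 1, η => 𝓜.Φbar (l + k) (semigroup l k η)

/-- The weak Lipschitz condition on the mappings `Φ_l`, `l ≥ 1`, with the kernels `Γ_l` and the
constants `Λ_l`. -/
def WeakLipschitz (Γ : ∀ l, BddMeas (S (l + 1)) → FunMeasure.{u, w} (S l)) (Λ : ℕ → ℝ≥0) : Prop :=
  ∀ l (f : BddMeas (S (l + 1))),
    (∀ μ ν : ProbabilityMeasure (S l),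
      ENNReal.ofReal |diffInt (𝓜.Φ l μ : Measure (S (l + 1))) (𝓜.Φ l ν) f.1|
        ≤ (Γ l f).lint fun g => |diffInt (μ : Measure (S l)) ν g|) ∧
    (Γ l f).lint supNorm ≤ (Λ (l + 1) : ℝ≥0∞) * ENNReal.ofReal (supNorm f.1)

/-- The Lipschitz and mixing conditions on the Markov transitions. At level `0` the transition
does not depend on a measure, so that only the mixing condition remains. -/
def Regular (c : ℕ → ℝ≥0) (n : ℕ → ℕ) : Prop :=
  (∀ l (μ ν : ProbabilityMeasure (S l)),
    kernelDist ((𝓜.M l).sectR μ) ((𝓜.M l).sectR ν)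
      ≤ c (l + 1) * tvDist (μ : Measure (S l)) ν) ∧
  ∀ l, 𝓜.b l (n l) < 1

/-- Exponential stability of the time averaged semigroup. -/
def ExpStable (lam₁ lam₂ : ℝ) (k₀ : ℕ) : Prop :=
  ∀ l (η μ : ℕ → ProbabilityMeasure (S l)) k, k₀ ≤ k →
    flowDist (𝓜.semigroup l k η) (𝓜.semigroup l k μ) ≤ lam₁ * Real.exp (-lam₂ * k)

end Model

/-! ### The chains -/

section Chains

variable {Ω : Type v} [mΩ : MeasurableSpace Ω]

/-- Conditionally on the `σ`-algebra `𝒢`, the process `Y` is a Markov chain with initial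
distribution `ν` and (random) transition `T n ω` between the times `n` and `n + 1`. -/
structure IsMarkovChainGiven {E : Type u} [mE : MeasurableSpace E] (P : Measure Ω)
    (𝒢 : MeasurableSpace Ω) (Y : ℕ → Ω → E) (ν : ProbabilityMeasure E)
    (T : ℕ → Ω → E → Measure E) : Prop where
  measurable : ∀ n, Measurable[mΩ, mE] (Y n)
  initial : ∀ A, MeasurableSet A →
    P⟦Y 0 ⁻¹' A | 𝒢⟧ =ᵐ[P] fun _ => (ν : Measure E).real A
  transition : ∀ n A, MeasurableSet A →
    P⟦Y (n + 1) ⁻¹' A | 𝒢 ⊔ ⨆ q ∈ Finset.range (n + 1), mE.comap (Y q)⟧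
      =ᵐ[P] fun ω => (T n ω (Y n ω)).real A

variable {S : ℕ → Type u} [mS : ∀ l, MeasurableSpace (S l)]

/-- `X l n ω` is the state at time `n` of the chain of level `l`. The chain of level `0` is a Markov
chain with transition `M^{(0)}`; given the whole chain of level `l`, the chain of level `l + 1` is a
Markov chain whose transition at time `n` is `M_η^{(l+1)}`, `η` being the occupation measure at
time `n` of the chain of level `l`. -/
structure IsIMCMC (𝓜 : Model S) (P : Measure Ω) (X : ∀ l, ℕ → Ω → S l) : Prop where
  base : IsMarkovChainGiven P ⊥ (X 0) (𝓜.ν 0) (fun _ _ x => 𝓜.M₀ x)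
  step : ∀ l, IsMarkovChainGiven P (⨆ p, (mS l).comap (X l p)) (X (l + 1)) (𝓜.ν (l + 1))
    (fun n ω x => 𝓜.M l (occupation (fun p => X l p ω) n, x))

/-- The `𝕃_r` error `E(|[η_n^{(l)} - π^{(l)}](f)|^r)^{1/r}`. -/
def lrError (𝓜 : Model S) (P : Measure Ω) (X : ∀ l, ℕ → Ω → S l) (r : ℝ) (l n : ℕ)
    (f : S l → ℝ) : ℝ :=
  (∫ ω, |diffInt (occupation (fun p => X l p ω) n : Measure (S l)) (𝓜.target l) f| ^ r ∂P) ^ (1 / r)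

end Chains

end IMCMC

end

open IMCMC

noncomputable section

namespace IMCMC

/-! ### Oscillation bounds -/

section OscLe

variable {E : Type u}

/-! The proof has a local estimate on each level, a propagation of local errors through the levels,
and a choice of the number of levels.

Local estimate. Given level `l`, the chain of level `l + 1` has a slowly drifting transition: the
occupation measures at times `n` and `n + 1` differ by at most `2 / (n + 2)` in total variation.
With the truncated potential `g = ∑_{k < N} M^k f`, which satisfies `M g = g + M^N f - f`, the sum
of `f(X_p) - Φ(η_p)(f)` splits into bounded martingale increments, boundary terms, the variation of
`g` as the parameter moves, and a remainder that vanishes as `N → ∞`. For a mixing exponent `m ≥ 1`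
and `R = m / (1 - b)`, the oscillation of `g` is at most `R` times that of `f` (`OscLe.potential`),
and `g` depends on the transition in a Lipschitz way with a constant of order `R²`
(`oscLe_potential_sub`), both uniformly in `N`. With a Khinchine type inequality for the martingale
(`eLpNorm_sum_le_of_orthogonal`), the occupation measures of level `l + 1` are within `16 r A /
√(n+1)` of the time averaged image of those of level `l`, in `𝕃_r` (`flowClose_occupation`).

Propagation. By Minkowski's inequality under `Γ`, the map `Φ` multiplies such an error by `Λ`;
averaging the rates `1 / √(p+1)` over `p ≤ n` costs a factor `2` and keeps the rate
(`FlowClose.Φbar`). So `k` levels produce `16 r A ∑_{j < k} B^j / √(n+1)`, and stability bounds the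
influence of the flow `k` levels below by `λ₁ e^{-λ₂ k}`. Levels below `k` are compared with their
targets directly from level `0`. This is `lrError_le_of_stable`.

Choice of `k`. Taking `k` to be the integer part of `log(n+1) / (2 (λ₂ + log B))` gives both terms
the same power of `n + 1`, up to the factor `k` when `B = 1`. -/

/-- The oscillation of `f` is at most `D`. -/
def OscLe (f : E → ℝ) (D : ℝ) : Prop := ∀ x y, |f x - f y| ≤ D

lemma OscLe.nonneg [hE : Nonempty E] {f : E → ℝ} {D : ℝ} (h : OscLe f D) : 0 ≤ D :=
  hE.elim fun x => (abs_nonneg _).trans (h x x)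

lemma OscLe.mono {f : E → ℝ} {D D' : ℝ} (h : OscLe f D) (hD : D ≤ D') : OscLe f D' :=
  fun x y => (h x y).trans hD

lemma OscLe.of_bound {f : E → ℝ} {C : ℝ} (h : ∀ x, |f x| ≤ C) : OscLe f (2 * C) := fun x y => by
  have h1 := h x
  have h2 := h y
  rw [abs_le] at *
  constructor <;> linarith

lemma OscLe.add {f g : E → ℝ} {D D' : ℝ} (hf : OscLe f D) (hg : OscLe g D') :
    OscLe (fun x => f x + g x) (D + D') := fun x y => by
  have : f x + g x - (f y + g y) = (f x - f y) + (g x - g y) := by ring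
  rw [this]
  exact (abs_add_le _ _).trans (add_le_add (hf x y) (hg x y))

lemma OscLe.sum {ι : Type*} (s : Finset ι) {f : ι → E → ℝ} {D : ι → ℝ}
    (h : ∀ i ∈ s, OscLe (f i) (D i)) : OscLe (fun x => ∑ i ∈ s, f i x) (∑ i ∈ s, D i) :=
  fun x y => by
    rw [← Finset.sum_sub_distrib]
    exact (Finset.abs_sum_le_sum_abs _ _).trans (Finset.sum_le_sum fun i hi => h i hi x y)

lemma OscLe.bounded {f : E → ℝ} {D : ℝ} (h : OscLe f D) : ∃ C, ∀ x, |f x| ≤ C := by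
  rcases isEmpty_or_nonempty E with hE | ⟨⟨x₀⟩⟩
  · exact ⟨0, fun x => hE.elim x⟩
  · refine ⟨|f x₀| + D, fun x => ?_⟩
    have h1 := h x x₀
    have h2 := abs_sub_abs_le_abs_sub (f x) (f x₀)
    linarith

lemma osc_le_of_oscLe {f : E → ℝ} {D : ℝ} (hD : 0 ≤ D) (h : OscLe f D) : osc f ≤ D :=
  Real.iSup_le (fun p => h p.1 p.2) hD

lemma OscLe.osc_bddAbove {f : E → ℝ} {D : ℝ} (h : OscLe f D) :
    BddAbove (Set.range fun p : E × E => |f p.1 - f p.2|) :=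
  ⟨D, by rintro _ ⟨p, rfl⟩; exact h p.1 p.2⟩

end OscLe

/-! ### Integrals of functions of bounded oscillation and total variation -/

section Oscillation

variable {E : Type u} [MeasurableSpace E]

lemma integrable_of_abs_le {Ω : Type*} [MeasurableSpace Ω] (μ : Measure Ω) [IsFiniteMeasure μ]
    {f : Ω → ℝ} (hf : Measurable f) {C : ℝ} (h : ∀ x, |f x| ≤ C) : Integrable f μ :=
  Integrable.of_bound hf.aestronglyMeasurable C (Filter.Eventually.of_forall h)

lemma OscLe.integrable (μ : Measure E) [IsFiniteMeasure μ] {f : E → ℝ} {D : ℝ}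
    (hf : Measurable f) (h : OscLe f D) : Integrable f μ :=
  let ⟨_, hC⟩ := h.bounded
  integrable_of_abs_le μ hf hC

lemma abs_integral_le_of_abs_le (μ : Measure E) [IsProbabilityMeasure μ] {f : E → ℝ} {C : ℝ}
    (h : ∀ x, |f x| ≤ C) : |∫ x, f x ∂μ| ≤ C := by
  simpa using norm_integral_le_of_norm_le_const (μ := μ) (f := f) (Filter.Eventually.of_forall h)

lemma OscLe.abs_sub_integral_le (μ : Measure E) [IsProbabilityMeasure μ] {f : E → ℝ} {D : ℝ}
    (hf : Measurable f) (h : OscLe f D) (x : E) : |f x - ∫ y, f y ∂μ| ≤ D := by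
  have : f x - ∫ y, f y ∂μ = ∫ y, (f x - f y) ∂μ := by
    rw [integral_sub (integrable_const _) (h.integrable μ hf)]; simp
  rw [this]
  exact abs_integral_le_of_abs_le μ (h x)

lemma OscLe.abs_diffInt_le (μ ν : Measure E) [IsProbabilityMeasure μ] [IsProbabilityMeasure ν]
    {f : E → ℝ} {D : ℝ} (hf : Measurable f) (h : OscLe f D) : |diffInt μ ν f| ≤ D := by
  have : diffInt μ ν f = ∫ x, (f x - ∫ y, f y ∂ν) ∂μ := by
    rw [integral_sub (h.integrable μ hf) (integrable_const _)]; simp [diffInt]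
  rw [this]
  exact abs_integral_le_of_abs_le μ (h.abs_sub_integral_le ν hf)

lemma abs_diffInt_le_two (μ ν : Measure E) [IsProbabilityMeasure μ] [IsProbabilityMeasure ν]
    {f : E → ℝ} {C : ℝ} (h : ∀ x, |f x| ≤ C) : |diffInt μ ν f| ≤ 2 * C := by
  have h1 := abs_integral_le_of_abs_le μ h
  have h2 := abs_integral_le_of_abs_le ν h
  unfold diffInt
  rw [abs_le] at *
  constructor <;> linarith

lemma bddAbove_tvDist (μ ν : Measure E) [IsProbabilityMeasure μ] [IsProbabilityMeasure ν] :
    BddAbove (Set.range fun f : UnitBall E => |diffInt μ ν f.1|) :=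
  ⟨2 * 1, by rintro _ ⟨f, rfl⟩; exact abs_diffInt_le_two μ ν f.2.2⟩

lemma tvDist_nonneg (μ ν : Measure E) : 0 ≤ tvDist μ ν :=
  Real.iSup_nonneg fun _ => abs_nonneg _

lemma tvDist_le_of_forall {μ ν : Measure E} {C : ℝ}
    (h : ∀ f : E → ℝ, Measurable f → (∀ x, |f x| ≤ 1) → |diffInt μ ν f| ≤ C) : tvDist μ ν ≤ C := by
  have : Nonempty (UnitBall E) := ⟨⟨fun _ => 0, measurable_const, by simp⟩⟩
  exact ciSup_le fun f => h f.1 f.2.1 f.2.2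

lemma tvDist_le_two (μ ν : Measure E) [IsProbabilityMeasure μ] [IsProbabilityMeasure ν] :
    tvDist μ ν ≤ 2 :=
  tvDist_le_of_forall fun _ _ h => by simpa using abs_diffInt_le_two μ ν h

lemma abs_diffInt_le_tvDist (μ ν : Measure E) [IsProbabilityMeasure μ] [IsProbabilityMeasure ν]
    {f : E → ℝ} (hf : Measurable f) {C : ℝ} (hC : 0 ≤ C) (h : ∀ x, |f x| ≤ C) :
    |diffInt μ ν f| ≤ C * tvDist μ ν := by
  rcases hC.eq_or_lt with rfl | hC
  · simpa using abs_diffInt_le_two μ ν h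
  · have h1 := le_ciSup (bddAbove_tvDist μ ν) ⟨fun x => f x / C, hf.div_const C, fun x => by
      rw [abs_div, abs_of_pos hC, div_le_one hC]; exact h x⟩
    have h2 : |diffInt μ ν fun x => f x / C| = |diffInt μ ν f| / C := by
      rw [← abs_of_pos hC, ← abs_div, abs_of_pos hC]
      simp only [diffInt, integral_div, sub_div]
    simp only [h2] at h1
    rw [div_le_iff₀ hC, mul_comm] at h1
    exact h1

lemma diffInt_sub_const (μ ν : Measure E) [IsProbabilityMeasure μ] [IsProbabilityMeasure ν]
    {f : E → ℝ} {D : ℝ} (hf : Measurable f) (h : OscLe f D) (a : ℝ) :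
    diffInt μ ν (fun x => f x - a) = diffInt μ ν f := by
  simp only [diffInt]
  rw [integral_sub (h.integrable μ hf) (integrable_const _),
    integral_sub (h.integrable ν hf) (integrable_const _)]
  simp

/-- Two probability measures do not see constants, so `f` may be centred at one of its values; its
uniform norm is then at most its oscillation. -/
lemma OscLe.abs_diffInt_le_tvDist (μ ν : Measure E) [IsProbabilityMeasure μ]
    [IsProbabilityMeasure ν] {f : E → ℝ} {D : ℝ} (hf : Measurable f) (h : OscLe f D) :
    |diffInt μ ν f| ≤ D * tvDist μ ν := by
  have hE : Nonempty E := nonempty_of_isProbabilityMeasure μ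
  obtain ⟨x₀⟩ := id hE
  rw [← diffInt_sub_const μ ν hf h (f x₀)]
  exact IMCMC.abs_diffInt_le_tvDist μ ν (hf.sub_const _) h.nonneg fun x => h x x₀

end Oscillation

/-! ### Dobrushin contraction, truncated potentials and their perturbation -/

section Action

variable {E : Type u} [MeasurableSpace E]

/-- The action `L(f)` of a transition on functions. -/
def act (L : Kernel E E) (f : E → ℝ) (x : E) : ℝ := ∫ y, f y ∂(L x)

lemma measurable_act (L : Kernel E E) [IsMarkovKernel L] {f : E → ℝ} (hf : Measurable f) :
    Measurable (act L f) :=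
  (hf.stronglyMeasurable.integral_kernel (κ := L)).measurable

lemma OscLe.act (L : Kernel E E) [IsMarkovKernel L] {f : E → ℝ} {D : ℝ} (hf : Measurable f)
    (h : OscLe f D) : OscLe (act L f) D :=
  fun x y => h.abs_diffInt_le (L x) (L y) hf

lemma dobrushin_bddAbove (L : Kernel E E) [IsMarkovKernel L] :
    BddAbove (Set.range fun f : Osc1 E => osc (fun x => ∫ y, f.1 y ∂(L x))) :=
  ⟨1, by
    rintro _ ⟨f, rfl⟩
    exact osc_le_of_oscLe zero_le_one (OscLe.act (D := 1) L f.2.1 f.2.2)⟩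

lemma dobrushin_nonneg (L : Kernel E E) : 0 ≤ dobrushin L :=
  Real.iSup_nonneg fun _ => Real.iSup_nonneg fun _ => abs_nonneg _

lemma dobrushin_le_one (L : Kernel E E) [IsMarkovKernel L] : dobrushin L ≤ 1 :=
  Real.iSup_le (fun f => osc_le_of_oscLe zero_le_one (OscLe.act (D := 1) L f.2.1 f.2.2)) zero_le_one

lemma OscLe.act_dobrushin (L : Kernel E E) [IsMarkovKernel L] {f : E → ℝ} {D : ℝ}
    (hf : Measurable f) (h : OscLe f D) : OscLe (IMCMC.act L f) (dobrushin L * D) := by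
  intro x y
  have : Nonempty E := ⟨x⟩
  rcases h.nonneg.eq_or_lt with rfl | hD
  · simpa using h.act L hf x y
  · have h' : OscLe (fun x => f x / D) 1 := fun x y => by
      rw [← sub_div, abs_div, abs_of_pos hD, div_le_one hD]; exact h x y
    have h1 := le_ciSup (dobrushin_bddAbove L) ⟨fun x => f x / D, hf.div_const D, h'⟩
    have h2 := le_ciSup (h'.act L (hf.div_const D)).osc_bddAbove (x, y)
    have h3 := h2.trans h1
    have h4 : |IMCMC.act L (fun x => f x / D) x - IMCMC.act L (fun x => f x / D) y|
        = |IMCMC.act L f x - IMCMC.act L f y| / D := by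
      rw [← abs_of_pos hD, ← abs_div, abs_of_pos hD]
      simp only [IMCMC.act, integral_div, sub_div]
    simp only [h4] at h3
    exact (div_le_iff₀ hD).1 h3

instance isMarkovKernel_pow (L : Kernel E E) [IsMarkovKernel L] (k : ℕ) :
    IsMarkovKernel (L ^ k) := by
  induction k with
  | zero => exact inferInstanceAs (IsMarkovKernel Kernel.id)
  | succ k ih => exact inferInstanceAs (IsMarkovKernel ((L ^ k) ∘ₖ L))

lemma act_comp (L M : Kernel E E) [IsMarkovKernel L] [IsMarkovKernel M] {f : E → ℝ}
    {D : ℝ} (hf : Measurable f) (h : OscLe f D) : act (L ∘ₖ M) f = act M (act L f) := by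
  funext x
  exact Kernel.integral_comp (h.integrable ((L ∘ₖ M) x) hf)

lemma act_pow_zero (L : Kernel E E) {f : E → ℝ} (hf : Measurable f) : act (L ^ 0) f = f := by
  funext x
  change ∫ y, f y ∂(Kernel.id x) = f x
  rw [Kernel.id_apply, integral_dirac' _ _ hf.stronglyMeasurable]

lemma act_pow_add (L : Kernel E E) [IsMarkovKernel L] (j k : ℕ) {f : E → ℝ}
    {D : ℝ} (hf : Measurable f) (h : OscLe f D) :
    act (L ^ (j + k)) f = act (L ^ j) (act (L ^ k) f) := by
  rw [add_comm, pow_add]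
  exact act_comp _ _ hf h

lemma act_pow_succ (L : Kernel E E) [IsMarkovKernel L] (k : ℕ) {f : E → ℝ}
    {D : ℝ} (hf : Measurable f) (h : OscLe f D) : act (L ^ (k + 1)) f = act L (act (L ^ k) f) := by
  rw [add_comm, act_pow_add L 1 k hf h, pow_one]

lemma act_add (L : Kernel E E) [IsMarkovKernel L] {f g : E → ℝ} {D D' : ℝ} (hf : Measurable f)
    (h : OscLe f D) (hg : Measurable g) (h' : OscLe g D') :
    act L (fun x => f x + g x) = fun x => act L f x + act L g x := by
  funext x
  exact integral_add (h.integrable _ hf) (h'.integrable _ hg)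

lemma act_sum (L : Kernel E E) [IsMarkovKernel L] {ι : Type*} (s : Finset ι) {f : ι → E → ℝ}
    {D : ι → ℝ} (hf : ∀ i, Measurable (f i)) (h : ∀ i, OscLe (f i) (D i)) :
    act L (fun x => ∑ i ∈ s, f i x) = fun x => ∑ i ∈ s, act L (f i) x := by
  funext x
  exact integral_finsetSum _ fun i _ => (h i).integrable _ (hf i)

/-- Each full block of `m` steps contracts by `b`; the `k % m` steps left over do not expand. -/
lemma OscLe.act_pow (L : Kernel E E) [IsMarkovKernel L] {m : ℕ} (hm : 1 ≤ m) {b : ℝ}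
    (hb : dobrushin (L ^ m) ≤ b) (k : ℕ) {f : E → ℝ} {D : ℝ} (hf : Measurable f) (h : OscLe f D) :
    OscLe (IMCMC.act (L ^ k) f) (b ^ (k / m) * D) := by
  rcases isEmpty_or_nonempty E with hE | hE
  · exact fun x => hE.elim x
  induction k using Nat.strong_induction_on with
  | _ k ih =>
    rcases lt_or_ge k m with hk | hk
    · rw [Nat.div_eq_of_lt hk]
      simpa using h.act (L ^ k) hf
    · obtain ⟨j, rfl⟩ := Nat.exists_eq_add_of_le hk
      have h1 := ih j (by omega)
      rw [act_pow_add L m j hf h, Nat.add_div_left _ (by omega), pow_succ', mul_assoc]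
      refine (h1.act_dobrushin (L ^ m) (measurable_act _ hf)).mono ?_
      exact mul_le_mul_of_nonneg_right hb h1.nonneg

lemma sum_pow_div_le {b : ℝ} (hb : 0 ≤ b) (hb1 : b < 1) {m : ℕ} (hm : 1 ≤ m) (N : ℕ) :
    ∑ k ∈ Finset.range N, b ^ (k / m) ≤ m / (1 - b) := by
  have h1 : ∑ k ∈ Finset.range N, b ^ (k / m) ≤ ∑ k ∈ Finset.range (N * m), b ^ (k / m) :=
    Finset.sum_le_sum_of_subset_of_nonneg
      (Finset.range_mono (Nat.le_mul_of_pos_right N hm)) fun _ _ _ => pow_nonneg hb _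
  have h2 : ∑ k ∈ Finset.range (N * m), b ^ (k / m) = m * ∑ j ∈ Finset.range N, b ^ j := by
    clear h1
    induction N with
    | zero => simp
    | succ N ih =>
      rw [Nat.succ_mul, Finset.sum_range_add, ih, Finset.sum_range_succ, mul_add]
      congr 1
      rw [Finset.sum_congr rfl (g := fun _ => b ^ N)]
      · simp
      · intro i hi
        rw [mul_comm N m, Nat.mul_add_div (by omega), Nat.div_eq_of_lt (Finset.mem_range.1 hi)]
        rfl
  rw [h2] at h1
  refine h1.trans ?_
  rw [div_eq_mul_inv]
  refine mul_le_mul_of_nonneg_left ?_ (Nat.cast_nonneg m)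
  rw [← tsum_geometric_of_lt_one hb hb1]
  exact (summable_geometric_of_lt_one hb hb1).sum_le_tsum _ fun _ _ => pow_nonneg hb _

/-- The truncated potential `∑_{k < N} L^k(f)`. -/
def potential (L : Kernel E E) (f : E → ℝ) (N : ℕ) (x : E) : ℝ :=
  ∑ k ∈ Finset.range N, act (L ^ k) f x

lemma measurable_potential (L : Kernel E E) [IsMarkovKernel L] {f : E → ℝ} (hf : Measurable f)
    (N : ℕ) : Measurable (potential L f N) :=
  Finset.measurable_fun_sum _ fun k _ => measurable_act (L ^ k) hf

/-- The Poisson equation up to the remainder `L^N f`. Truncation avoids any question of convergence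
of the full series. -/
lemma act_potential (L : Kernel E E) [IsMarkovKernel L] {f : E → ℝ} {D : ℝ} (hf : Measurable f)
    (h : OscLe f D) (N : ℕ) (x : E) :
    act L (potential L f N) x = potential L f N x + act (L ^ N) f x - f x := by
  have h1 : act L (potential L f N) x = ∑ k ∈ Finset.range N, act (L ^ (k + 1)) f x := by
    have := congrFun (act_sum L (Finset.range N) (fun k => measurable_act (L ^ k) hf)
      (fun k => h.act (L ^ k) hf)) x
    refine this.trans (Finset.sum_congr rfl fun k _ => ?_)
    rw [act_pow_succ L k hf h]
  have h2 := Finset.sum_range_succ (fun k => act (L ^ k) f x) N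
  rw [Finset.sum_range_succ' , act_pow_zero L hf] at h2
  rw [h1, potential]
  linarith

lemma OscLe.potential (L : Kernel E E) [IsMarkovKernel L] {m : ℕ} (hm : 1 ≤ m) {b : ℝ}
    (hb : dobrushin (L ^ m) ≤ b) (hb1 : b < 1) (N : ℕ) {f : E → ℝ} {D : ℝ} (hf : Measurable f)
    (h : OscLe f D) : OscLe (IMCMC.potential L f N) (m / (1 - b) * D) := by
  rcases isEmpty_or_nonempty E with hE | hE
  · exact fun x => hE.elim x
  refine (OscLe.sum (Finset.range N) fun k _ => h.act_pow L hm hb k hf).mono ?_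
  rw [← Finset.sum_mul]
  exact mul_le_mul_of_nonneg_right
    (sum_pow_div_le ((dobrushin_nonneg _).trans hb) hb1 hm N) h.nonneg

/-- With `G_N` the potential, `G_{N+1} = f + L G_N`, so the difference of the two potentials solves
`Δ_{N+1} = L Δ_N + (L - M) G_N^M`. One factor `m / (1 - b)` bounds the source term, the other sums
its contractions under the powers of `L`; the bound is uniform in `N`. -/
lemma oscLe_potential_sub (L M : Kernel E E) [IsMarkovKernel L] [IsMarkovKernel M] {m : ℕ}
    (hm : 1 ≤ m) {b : ℝ} (hL : dobrushin (L ^ m) ≤ b) (hM : dobrushin (M ^ m) ≤ b) (hb1 : b < 1)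
    {d : ℝ} (hd : ∀ x, tvDist (L x) (M x) ≤ d) (N : ℕ) {f : E → ℝ} {D : ℝ}
    (hf : Measurable f) (h : OscLe f D) :
    OscLe (fun x => potential L f N x - potential M f N x)
      (2 * d * (m / (1 - b)) ^ 2 * D) := by
  rcases isEmpty_or_nonempty E with hE | hE
  · exact fun x => hE.elim x
  have hD := h.nonneg
  have hb : 0 ≤ b := (dobrushin_nonneg _).trans hL
  set R : ℝ := m / (1 - b) with hR
  have hR0 : 0 ≤ R := div_nonneg (Nat.cast_nonneg m) (by linarith)
  have hd0 : 0 ≤ d := hE.elim fun x => (tvDist_nonneg _ _).trans (hd x)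
  set U : ℝ := 2 * d * (R * D) with hU
  have hpos : ∀ N, OscLe (potential M f N) (R * D) := fun N => h.potential M hm hM hb1 N hf
  have hposL : ∀ N, OscLe (potential L f N) (R * D) := fun N => h.potential L hm hL hb1 N hf
  -- the perturbation `(L - M)(g)`
  have hu : ∀ N, OscLe (fun x => act L (potential M f N) x - act M (potential M f N) x) U := by
    intro N
    have h0 : ∀ x, |act L (potential M f N) x - act M (potential M f N) x| ≤ d * (R * D) := by
      intro x
      refine ((hpos N).abs_diffInt_le_tvDist (L x) (M x) (measurable_potential M hf N)).trans ?_
      rw [mul_comm]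
      exact mul_le_mul_of_nonneg_right (hd x) (mul_nonneg hR0 hD)
    have := OscLe.of_bound h0
    rwa [← mul_assoc 2] at this
  have hmeas : ∀ N, Measurable (fun x => act L (potential M f N) x - act M (potential M f N) x) :=
    fun N => (measurable_act L (measurable_potential M hf N)).sub
      (measurable_act M (measurable_potential M hf N))
  have hmeas' : ∀ N, Measurable (fun x => potential L f N x - potential M f N x) :=
    fun N => (measurable_potential L hf N).sub (measurable_potential M hf N)
  have hosc' : ∀ N, OscLe (fun x => potential L f N x - potential M f N x) (R * D + R * D) := by
    intro N x y
    have h1 := hposL N x y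
    have h2 := hpos N x y
    rw [abs_le] at *
    constructor <;> linarith
  have step : ∀ N, (fun x => potential L f (N + 1) x - potential M f (N + 1) x) =
      fun x => act L (fun x => potential L f N x - potential M f N x) x
        + (act L (potential M f N) x - act M (potential M f N) x) := by
    intro N
    funext x
    have h1 : act L (fun x => potential L f N x - potential M f N x) x
        = act L (potential L f N) x - act L (potential M f N) x :=
      integral_sub ((hposL N).integrable _ (measurable_potential L hf N))
        ((hpos N).integrable _ (measurable_potential M hf N))
    rw [h1, act_potential L hf h, act_potential M hf h]
    simp only [potential, Finset.sum_range_succ]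
    ring
  -- The extra power `L^j` is carried through the induction: the recursion moves one `L` from
  -- `Δ_{N+1}` to the front of `Δ_N`, so the exponents of `b` accumulate and the sum stays bounded.
  have key : ∀ N j, OscLe (act (L ^ j) fun x => potential L f N x - potential M f N x)
      (∑ i ∈ Finset.range N, b ^ ((i + j) / m) * U) := by
    intro N
    induction N with
    | zero => intro j x y; simp [potential, act]
    | succ N ih =>
      intro j
      rw [step N, act_add (L ^ j) (measurable_act L (hmeas' N)) ((hosc' N).act L (hmeas' N))
        (hmeas N) (hu N), Finset.sum_range_succ']
      refine OscLe.add ?_ ?_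
      · have h2 := ih (j + 1)
        rw [act_pow_add L j 1 (hmeas' N) (hosc' N), pow_one] at h2
        refine h2.mono (le_of_eq (Finset.sum_congr rfl fun i _ => ?_))
        rw [show i + (j + 1) = i + 1 + j by ring]
      · rw [zero_add]
        exact (hu N).act_pow L hm hL j (hmeas N)
  have := key N 0
  rw [act_pow_zero L (hmeas' N)] at this
  refine this.mono ?_
  rw [← Finset.sum_mul]
  simp only [add_zero]
  calc _ ≤ R * U := mul_le_mul_of_nonneg_right (sum_pow_div_le hb hb1 hm N) (by positivity)
    _ = _ := by rw [hU]; ring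

lemma integral_act_of_invariant {L : Kernel E E} [IsMarkovKernel L] {π : Measure E}
    [IsProbabilityMeasure π] (hπ : L.Invariant π) (k : ℕ) {f : E → ℝ} {D : ℝ} (hf : Measurable f)
    (h : OscLe f D) : ∫ x, act (L ^ k) f x ∂π = ∫ x, f x ∂π := by
  induction k with
  | zero => rw [act_pow_zero L hf]
  | succ k ih =>
    have h1 := h.act (L ^ k) hf
    have hm := measurable_act (L ^ k) hf
    rw [act_pow_succ L k hf h, ← ih]
    obtain ⟨x₀⟩ := nonempty_of_isProbabilityMeasure π
    -- Viewing `π` as a constant kernel turns invariance into a composition of kernels.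
    have h2 : (L ∘ₖ Kernel.const E π) x₀ = π := by rw [hπ.comp_const, Kernel.const_apply]
    have h3 := Kernel.integral_comp (η := L) (κ := Kernel.const E π) (a := x₀)
      (f := act (L ^ k) f) (by rw [h2]; exact h1.integrable π hm)
    rw [h2, Kernel.const_apply] at h3
    exact h3.symm

lemma abs_act_pow_sub_integral_le {L : Kernel E E} [IsMarkovKernel L] {π : Measure E}
    [IsProbabilityMeasure π] (hπ : L.Invariant π) {m : ℕ} (hm : 1 ≤ m) {b : ℝ}
    (hb : dobrushin (L ^ m) ≤ b) (k : ℕ) {f : E → ℝ} {D : ℝ} (hf : Measurable f) (h : OscLe f D)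
    (x : E) : |act (L ^ k) f x - ∫ y, f y ∂π| ≤ b ^ (k / m) * D := by
  rw [← integral_act_of_invariant hπ k hf h]
  exact (h.act_pow L hm hb k hf).abs_sub_integral_le π (measurable_act _ hf) x

end Action

/-! ### Measurable dependence on the parameter -/

section Parameter

variable {α : Type*} [MeasurableSpace α] {E : Type u} [MeasurableSpace E]

lemma measurable_act_sectR_pow (K : Kernel (α × E) E) [IsMarkovKernel K] {f : E → ℝ} {D : ℝ}
    (hf : Measurable f) (h : OscLe f D) (k : ℕ) :
    Measurable fun p : α × E => act (K.sectR p.1 ^ k) f p.2 := by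
  induction k with
  | zero =>
    simp only [act_pow_zero _ hf]
    exact hf.comp measurable_snd
  | succ k ih =>
    simp only [act_pow_succ _ k hf h]
    have h1 : Measurable fun q : (α × E) × E => act (K.sectR q.1.1 ^ k) f q.2 :=
      ih.comp ((measurable_fst.comp measurable_fst).prodMk measurable_snd)
    exact (h1.stronglyMeasurable.integral_kernel_prod_right' (κ := K)).measurable

lemma measurable_potential_sectR (K : Kernel (α × E) E) [IsMarkovKernel K] {f : E → ℝ} {D : ℝ}
    (hf : Measurable f) (h : OscLe f D) (N : ℕ) :
    Measurable fun p : α × E => potential (K.sectR p.1) f N p.2 :=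
  Finset.measurable_fun_sum _ fun k _ => measurable_act_sectR_pow K hf h k

lemma measurable_probabilityMeasure {π : α → ProbabilityMeasure E}
    (h : ∀ A, MeasurableSet A → Measurable fun a => (π a : Measure E).real A) : Measurable π := by
  have : Measurable fun a => (π a : Measure E) := by
    refine Measure.measurable_of_measurable_coe _ fun A hA => ?_
    have h1 : (fun a => (π a : Measure E) A) =
        fun a => ENNReal.ofReal ((π a : Measure E).real A) := by
      funext a; simp
    rw [h1]
    exact (h A hA).ennreal_ofReal
  exact this.subtype_mk

lemma measurable_integral_probabilityMeasure {π : α → ProbabilityMeasure E} (hπ : Measurable π)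
    {f : E → ℝ} (hf : Measurable f) : Measurable fun a => ∫ x, f x ∂(π a : Measure E) := by
  let κ : Kernel α E := ⟨fun a => (π a : Measure E), measurable_subtype_coe.comp hπ⟩
  exact (hf.stronglyMeasurable.integral_kernel (κ := κ)).measurable

/-- An invariant measure depends measurably on the parameter of a mixing transition. -/
lemma measurable_of_invariant [Nonempty E] (K : Kernel (α × E) E) [IsMarkovKernel K]
    {π : α → ProbabilityMeasure E} (hπ : ∀ a, (K.sectR a).Invariant (π a : Measure E)) {m : ℕ}
    (hm : 1 ≤ m) {b : ℝ} (hb : ∀ a, dobrushin (K.sectR a ^ m) ≤ b) (hb1 : b < 1) :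
    Measurable π := by
  obtain ⟨x₀⟩ := ‹Nonempty E›
  refine measurable_probabilityMeasure fun A hA => ?_
  have hf : Measurable (A.indicator fun _ : E => (1 : ℝ)) := measurable_const.indicator hA
  have h : OscLe (A.indicator fun _ : E => (1 : ℝ)) 1 := fun x y => by
    by_cases hx : x ∈ A <;> by_cases hy : y ∈ A <;> simp [hx, hy]
  -- Mixing makes `π a (A)` the limit of the probabilities of `A` after `k * m` steps from the fixed
  -- point `x₀`, which are measurable in `a`.
  refine measurable_of_tendsto_metrizable (f := fun k a =>
    act (K.sectR a ^ (k * m)) (A.indicator fun _ : E => (1 : ℝ)) x₀) (fun k => ?_) ?_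
  · exact (measurable_act_sectR_pow K hf h (k * m)).comp (measurable_id.prodMk measurable_const)
  · refine tendsto_pi_nhds.2 fun a => ?_
    have hb0 : 0 ≤ b := (dobrushin_nonneg _).trans (hb a)
    have h1 : ∫ y, A.indicator (fun _ : E => (1 : ℝ)) y ∂(π a : Measure E)
        = (π a : Measure E).real A := by
      rw [integral_indicator hA]; simp
    rw [← h1, tendsto_iff_norm_sub_tendsto_zero]
    refine squeeze_zero (fun _ => norm_nonneg _) (fun k => ?_)
      (tendsto_pow_atTop_nhds_zero_of_lt_one hb0 hb1)
    have := abs_act_pow_sub_integral_le (hπ a) hm (hb a) (k * m) hf h x₀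
    rwa [mul_one, Nat.mul_div_cancel _ (by omega)] at this

end Parameter

/-! ### From conditional probabilities of events to conditional integrals -/

section ConditionalLaw

variable {Ω : Type v} [mΩ : MeasurableSpace Ω] {E : Type u} [MeasurableSpace E]

/-- The hypothesis treats one event at a time; this is enough because rectangles determine the joint
law. No regular conditional distribution has to exist beforehand, so the spaces can be arbitrary. -/
lemma map_prodMk_eq_compProd {α : Type*} [mα : MeasurableSpace α] {P : Measure Ω}
    [IsProbabilityMeasure P] {W : Ω → α} (hW : Measurable W) {Y : Ω → E} (hY : Measurable Y)
    (κ : Kernel α E) [IsMarkovKernel κ]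
    (h : ∀ A, MeasurableSet A →
      P⟦Y ⁻¹' A | mα.comap W⟧ =ᵐ[P] fun ω => (κ (W ω)).real A) :
    P.map (fun ω => (W ω, Y ω)) = P.map W ⊗ₘ κ := by
  have : IsProbabilityMeasure (P.map W) := Measure.isProbabilityMeasure_map hW.aemeasurable
  have : IsProbabilityMeasure (P.map fun ω => (W ω, Y ω)) :=
    Measure.isProbabilityMeasure_map (hW.prodMk hY).aemeasurable
  refine Measure.ext_prod fun {s t} hs ht => ?_
  rw [Measure.map_apply (hW.prodMk hY) (hs.prod ht), Measure.compProd_apply_prod hs ht,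
    setLIntegral_map hs (κ.measurable_coe ht) hW]
  have hpre : (fun ω => (W ω, Y ω)) ⁻¹' s ×ˢ t = W ⁻¹' s ∩ Y ⁻¹' t := rfl
  rw [hpre]
  have h1 : ∫ ω in W ⁻¹' s, (κ (W ω)).real t ∂P = P.real (W ⁻¹' s ∩ Y ⁻¹' t) := by
    rw [← setIntegral_congr_ae (hW hs) ((h t ht).mono fun ω hω _ => hω),
      setIntegral_condExp hW.comap_le
        ((integrable_const (1 : ℝ)).indicator (hY ht)) ⟨s, hs, rfl⟩,
      integral_indicator (hY ht), Measure.restrict_restrict (hY ht)]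
    simp [Set.inter_comm, Measure.real]
  have h2 : Measurable fun ω => κ (W ω) t := (κ.measurable_coe ht).comp hW
  have h3 : ∫ ω in W ⁻¹' s, (κ (W ω)).real t ∂P = (∫⁻ ω in W ⁻¹' s, κ (W ω) t ∂P).toReal :=
    integral_toReal h2.aemeasurable (Filter.Eventually.of_forall fun ω => measure_lt_top _ _)
  rw [h3, Measure.real, ENNReal.toReal_eq_toReal_iff'] at h1
  · exact h1.symm
  · refine ne_top_of_le_ne_top (b := P Set.univ) (measure_ne_top _ _) ?_
    refine (setLIntegral_le_lintegral _ _).trans ((lintegral_mono fun ω => prob_le_one).trans ?_)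
    simp
  · exact measure_ne_top _ _

lemma integral_comp_prodMk {α : Type*} [mα : MeasurableSpace α] {P : Measure Ω}
    [IsProbabilityMeasure P] {W : Ω → α} (hW : Measurable W) {Y : Ω → E} (hY : Measurable Y)
    (κ : Kernel α E) [IsMarkovKernel κ]
    (h : ∀ A, MeasurableSet A →
      P⟦Y ⁻¹' A | mα.comap W⟧ =ᵐ[P] fun ω => (κ (W ω)).real A)
    {H : α × E → ℝ} (hH : Measurable H) {C : ℝ} (hC : ∀ p, |H p| ≤ C) :
    ∫ ω, H (W ω, Y ω) ∂P = ∫ ω, ∫ y, H (W ω, y) ∂(κ (W ω)) ∂P := by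
  have : IsProbabilityMeasure (P.map W) := Measure.isProbabilityMeasure_map hW.aemeasurable
  rw [← integral_map (hW.prodMk hY).aemeasurable hH.aestronglyMeasurable,
    map_prodMk_eq_compProd hW hY κ h, Measure.integral_compProd (integrable_of_abs_le _ hH hC),
    integral_map hW.aemeasurable]
  exact (hH.stronglyMeasurable.integral_kernel_prod_right' (κ := κ)).aestronglyMeasurable

/-- The increments `h(U, Y) - K(h)(U, V)` are orthogonal to the past when `K(U, V)` is the
conditional law of `Y`. -/
lemma integral_mul_sub_eq_zero {Ω : Type v} {ℱ mΩ : MeasurableSpace Ω} {E : Type u}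
    [MeasurableSpace E] {α : Type*} [MeasurableSpace α] {P : Measure Ω} [IsProbabilityMeasure P]
    (hℱ : ℱ ≤ mΩ) {U : Ω → α} {V Y : Ω → E}
    (hU : Measurable[ℱ] U) (hV : Measurable[ℱ] V) (hY : Measurable Y)
    (K : Kernel (α × E) E) [IsMarkovKernel K]
    (hK : ∀ A, MeasurableSet A → P⟦Y ⁻¹' A | ℱ⟧ =ᵐ[P] fun ω => (K (U ω, V ω)).real A)
    {h : α × E → ℝ} (hh : Measurable h) {C : ℝ} (hC : ∀ p, |h p| ≤ C)
    {Z : Ω → ℝ} (hZ : Measurable[ℱ] Z) {C' : ℝ} (hC' : ∀ ω, |Z ω| ≤ C') :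
    ∫ ω, Z ω * (h (U ω, Y ω) - ∫ y, h (U ω, y) ∂(K (U ω, V ω))) ∂P = 0 := by
  have hUm := hU.mono hℱ le_rfl
  have hVm := hV.mono hℱ le_rfl
  let κ : @Kernel Ω E ℱ _ := @Kernel.comap _ _ _ _ _ ℱ K (fun ω => (U ω, V ω)) (hU.prodMk hV)
  have hκ : IsMarkovKernel κ := by
    refine ⟨fun ω => ?_⟩
    change IsProbabilityMeasure (K (U ω, V ω))
    infer_instance
  have hfst : @Measurable _ _ (@Prod.instMeasurableSpace Ω E ℱ _) ℱ (Prod.fst : Ω × E → Ω) :=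
    @measurable_fst Ω E ℱ _
  have hsnd : @Measurable _ _ (@Prod.instMeasurableSpace Ω E ℱ _) _ (Prod.snd : Ω × E → E) :=
    @measurable_snd Ω E ℱ _
  have hH : @Measurable _ _ (@Prod.instMeasurableSpace Ω E ℱ _) _
      fun p : Ω × E => Z p.1 * h (U p.1, p.2) :=
    (hZ.comp hfst).mul (hh.comp ((hU.comp hfst).prodMk hsnd))
  -- The conditioning variable is the identity from `Ω` to `Ω` with the smaller σ-algebra `ℱ`, so
  -- that `Z`, `U` and `V` are all functions of it.
  have key := @integral_comp_prodMk Ω mΩ E _ Ω ℱ P _ id (measurable_id'' hℱ) Y hY κ hκ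
    (fun A hA => by rw [MeasurableSpace.comap_id]; exact hK A hA) _ hH (C' * C) (fun p => by
      rw [abs_mul]
      exact mul_le_mul (hC' _) (hC _) (abs_nonneg _) ((abs_nonneg _).trans (hC' p.1)))
  have hmean : Measurable fun p : α × E => ∫ y, h (p.1, y) ∂(K p) := by
    have h1 : Measurable fun q : (α × E) × E => h (q.1.1, q.2) :=
      hh.comp ((measurable_fst.comp measurable_fst).prodMk measurable_snd)
    exact (h1.stronglyMeasurable.integral_kernel_prod_right' (κ := K)).measurable
  have hZm := hZ.mono hℱ le_rfl
  have hb : ∀ ω {c : ℝ}, |c| ≤ C → |Z ω * c| ≤ C' * C := fun ω c hc => by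
    rw [abs_mul]
    exact mul_le_mul (hC' _) hc (abs_nonneg _) ((abs_nonneg _).trans (hC' ω))
  simp only [mul_sub]
  rw [integral_sub, sub_eq_zero]
  · refine key.trans (integral_congr_ae (Filter.Eventually.of_forall fun ω => ?_))
    exact integral_const_mul (Z ω) fun y => h (U ω, y)
  · exact integrable_of_abs_le P (hZm.mul (hh.comp (hUm.prodMk hY))) fun ω => hb ω (hC _)
  · exact integrable_of_abs_le P (hZm.mul (hmean.comp (hUm.prodMk hVm)))
      fun ω => hb ω (abs_integral_le_of_abs_le _ fun y => hC _)

end ConditionalLaw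

/-! ### Moments of sums of bounded martingale increments -/

section Martingale

lemma abs_sum_range_le {Ω : Type*} {D : ℕ → Ω → ℝ} {a : ℝ} (hDa : ∀ p ω, |D p ω| ≤ a)
    (N : ℕ) (ω : Ω) :
    |∑ p ∈ Finset.range N, D p ω| ≤ N * a := by
  refine (Finset.abs_sum_le_sum_abs _ _).trans ((Finset.sum_le_sum fun p _ => hDa p ω).trans ?_)
  simp

variable {Ω : Type v} [mΩ : MeasurableSpace Ω]

lemma rpow_le_mul_exp {r x : ℝ} (hr : 0 < r) (hx : 0 ≤ x) : x ^ r ≤ r ^ r * Real.exp x := by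
  have h1 : x / r ≤ Real.exp (x / r) := by linarith [Real.add_one_le_exp (x / r)]
  have h2 := Real.rpow_le_rpow (by positivity) h1 hr.le
  rw [← Real.exp_mul, div_mul_cancel₀ _ hr.ne', Real.div_rpow hx hr.le,
    div_le_iff₀ (by positivity)] at h2
  linarith

lemma eLpNorm_le_of_integral_rpow_le {P : Measure Ω} [IsProbabilityMeasure P] {f : Ω → ℝ}
    (hf : Measurable f) {M : ℝ} (hM : ∀ ω, |f ω| ≤ M) {r : ℝ} (hr : 1 ≤ r) {C : ℝ} (hC : 0 ≤ C)
    (h : ∫ ω, |f ω| ^ r ∂P ≤ C ^ r) : eLpNorm f (ENNReal.ofReal r) P ≤ ENNReal.ofReal C := by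
  have hr0 : 0 < r := by linarith
  have hL : MemLp f (ENNReal.ofReal r) P :=
    MemLp.of_bound hf.aestronglyMeasurable M (Filter.Eventually.of_forall hM)
  rw [hL.eLpNorm_eq_integral_rpow_norm (by simpa using hr0) ENNReal.ofReal_ne_top,
    ENNReal.toReal_ofReal hr0.le]
  refine ENNReal.ofReal_le_ofReal ?_
  calc (∫ ω, ‖f ω‖ ^ r ∂P) ^ r⁻¹ ≤ (C ^ r) ^ r⁻¹ :=
        Real.rpow_le_rpow (integral_nonneg fun ω => by positivity) h (by positivity)
    _ = C := Real.rpow_rpow_inv hC hr0.ne'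

/-- Since `e^x ≤ 1 + x + x²` for `|x| ≤ 1`, each increment costs a factor `1 + (|t| a)²`: its linear
term is killed by orthogonality to the exponential of the previous partial sum. -/
lemma integral_exp_sum_le {P : Measure Ω} [IsProbabilityMeasure P] {ℱ : ℕ → MeasurableSpace Ω}
    (hℱ : ∀ p, ℱ p ≤ mΩ) (hmono : Monotone ℱ) {D : ℕ → Ω → ℝ}
    (hD : ∀ p, Measurable[ℱ (p + 1)] (D p)) {a : ℝ} (hDa : ∀ p ω, |D p ω| ≤ a)
    (horth : ∀ p (Z : Ω → ℝ), Measurable[ℱ p] Z → (∃ C, ∀ ω, |Z ω| ≤ C) →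
      ∫ ω, Z ω * D p ω ∂P = 0) {t : ℝ} (ht : |t| * a ≤ 1) (N : ℕ) :
    ∫ ω, Real.exp (t * ∑ p ∈ Finset.range N, D p ω) ∂P ≤ (1 + (|t| * a) ^ 2) ^ N := by
  have hSm : ∀ N, Measurable[ℱ N] fun ω => Real.exp (t * ∑ p ∈ Finset.range N, D p ω) := by
    intro N
    refine Real.measurable_exp.comp (Measurable.const_mul ?_ t)
    refine Finset.measurable_fun_sum _ fun p hp => ?_
    exact (hD p).mono (hmono (Finset.mem_range.1 hp)) le_rfl
  have hSb : ∀ N ω, |Real.exp (t * ∑ p ∈ Finset.range N, D p ω)| ≤ Real.exp (|t| * (N * a)) := by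
    intro N ω
    rw [Real.abs_exp]
    refine Real.exp_le_exp.2 ((le_abs_self _).trans ?_)
    rw [abs_mul]
    exact mul_le_mul_of_nonneg_left (abs_sum_range_le hDa N ω) (abs_nonneg _)
  induction N with
  | zero => simp
  | succ N ih =>
    have hI : Integrable (fun ω => Real.exp (t * ∑ p ∈ Finset.range N, D p ω)) P :=
      integrable_of_abs_le P ((hSm N).mono (hℱ N) le_rfl) (hSb N)
    have hI1 := integrable_of_abs_le P ((hSm (N + 1)).mono (hℱ _) le_rfl) (hSb (N + 1))
    have hI2 : Integrable (fun ω => Real.exp (t * ∑ p ∈ Finset.range N, D p ω) * D N ω) P :=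
      integrable_of_abs_le P (((hSm N).mono (hℱ N) le_rfl).mul ((hD N).mono (hℱ _) le_rfl))
        (C := Real.exp (|t| * (N * a)) * a) fun ω => by
          rw [abs_mul]
          exact mul_le_mul (hSb N ω) (hDa N ω) (abs_nonneg _) (Real.exp_pos _).le
    have hpt : ∀ ω, Real.exp (t * ∑ p ∈ Finset.range (N + 1), D p ω) ≤
        t * (Real.exp (t * ∑ p ∈ Finset.range N, D p ω) * D N ω) +
          (1 + (|t| * a) ^ 2) * Real.exp (t * ∑ p ∈ Finset.range N, D p ω) := by
      intro ω
      rw [Finset.sum_range_succ, mul_add, Real.exp_add]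
      have h1 : |t * D N ω| ≤ |t| * a := by
        rw [abs_mul]; exact mul_le_mul_of_nonneg_left (hDa N ω) (abs_nonneg _)
      have h2 := (abs_le.1 (Real.abs_exp_sub_one_sub_id_le (h1.trans ht))).2
      have h3 : (t * D N ω) ^ 2 ≤ (|t| * a) ^ 2 := sq_le_sq' (abs_le.1 h1).1 (abs_le.1 h1).2
      have h4 : Real.exp (t * D N ω) ≤ t * D N ω + (1 + (|t| * a) ^ 2) := by linarith
      have h5 := mul_le_mul_of_nonneg_left h4
        (Real.exp_pos (t * ∑ p ∈ Finset.range N, D p ω)).le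
      linarith
    calc _ ≤ ∫ ω, (t * (Real.exp (t * ∑ p ∈ Finset.range N, D p ω) * D N ω) +
          (1 + (|t| * a) ^ 2) * Real.exp (t * ∑ p ∈ Finset.range N, D p ω)) ∂P :=
          integral_mono hI1 ((hI2.const_mul t).add (hI.const_mul _)) hpt
      _ = (1 + (|t| * a) ^ 2) * ∫ ω, Real.exp (t * ∑ p ∈ Finset.range N, D p ω) ∂P := by
          rw [integral_add (hI2.const_mul t) (hI.const_mul _), integral_const_mul,
            integral_const_mul, horth N _ (hSm N) ⟨_, hSb N⟩]
          ring
      _ ≤ (1 + (|t| * a) ^ 2) * (1 + (|t| * a) ^ 2) ^ N :=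
          mul_le_mul_of_nonneg_left ih (by positivity)
      _ = _ := (pow_succ' _ _).symm

/-- Khinchine type inequality for sums of bounded martingale increments. -/
lemma eLpNorm_sum_le_of_orthogonal {P : Measure Ω} [IsProbabilityMeasure P]
    {ℱ : ℕ → MeasurableSpace Ω}
    (hℱ : ∀ p, ℱ p ≤ mΩ) (hmono : Monotone ℱ) {D : ℕ → Ω → ℝ}
    (hD : ∀ p, Measurable[ℱ (p + 1)] (D p)) {a : ℝ} (ha : 0 < a) (hDa : ∀ p ω, |D p ω| ≤ a)
    (horth : ∀ p (Z : Ω → ℝ), Measurable[ℱ p] Z → (∃ C, ∀ ω, |Z ω| ≤ C) →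
      ∫ ω, Z ω * D p ω ∂P = 0) {r : ℝ} (hr : 1 ≤ r) {N : ℕ} (hN : 1 ≤ N) :
    eLpNorm (fun ω => ∑ p ∈ Finset.range N, D p ω) (ENNReal.ofReal r) P
      ≤ ENNReal.ofReal (6 * r * a * √N) := by
  have hN0 : (0 : ℝ) < N := by exact_mod_cast hN
  have hs : 0 < √(N : ℝ) := Real.sqrt_pos.2 hN0
  -- At this scale the exponential moments are at most `(1 + 1/N)^N ≤ e`. With `x^r ≤ r^r e^x` and
  -- `2e < 6` this gives the constant `6 r`.
  set t : ℝ := (a * √N)⁻¹ with ht_def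
  have ht : 0 < t := by positivity
  have hta : t * a = (√N)⁻¹ := by rw [ht_def]; field_simp
  have hta1 : t * a ≤ 1 := by
    rw [hta]
    refine inv_le_one_of_one_le₀ (Real.one_le_sqrt.2 (by exact_mod_cast hN))
  have hpow : (1 + (t * a) ^ 2) ^ N ≤ Real.exp 1 := by
    rw [hta, inv_pow, Real.sq_sqrt hN0.le]
    calc (1 + (N : ℝ)⁻¹) ^ N ≤ (Real.exp (N : ℝ)⁻¹) ^ N := by
          refine pow_le_pow_left₀ (by positivity) ?_ N
          linarith [Real.add_one_le_exp (N : ℝ)⁻¹]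
      _ = Real.exp 1 := by rw [← Real.exp_nat_mul, mul_inv_cancel₀ hN0.ne']
  set S : Ω → ℝ := fun ω => ∑ p ∈ Finset.range N, D p ω with hS
  have hSm : Measurable S := Finset.measurable_fun_sum _ fun p _ => (hD p).mono (hℱ _) le_rfl
  have hSb : ∀ ω, |S ω| ≤ N * a := abs_sum_range_le hDa N
  have hexp : ∀ s : ℝ, |s| = t → ∫ ω, Real.exp (s * S ω) ∂P ≤ Real.exp 1 := by
    intro s hs
    have h1 := integral_exp_sum_le hℱ hmono hD hDa horth (t := s) (by rwa [hs]) N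
    rw [hs] at h1
    exact h1.trans hpow
  have hint : ∀ s : ℝ, Integrable (fun ω => Real.exp (s * S ω)) P := by
    intro s
    refine integrable_of_abs_le P (Real.measurable_exp.comp (hSm.const_mul s))
      (C := Real.exp (|s| * (N * a))) fun ω => ?_
    rw [Real.abs_exp]
    refine Real.exp_le_exp.2 ((le_abs_self _).trans ?_)
    rw [abs_mul]
    exact mul_le_mul_of_nonneg_left (hSb ω) (abs_nonneg _)
  have hmain : ∫ ω, |t * S ω| ^ r ∂P ≤ (6 * r) ^ r := by
    have hpt : ∀ ω, |t * S ω| ^ r ≤ r ^ r * (Real.exp (t * S ω) + Real.exp (-t * S ω)) := by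
      intro ω
      refine (rpow_le_mul_exp (by linarith) (abs_nonneg _)).trans ?_
      refine mul_le_mul_of_nonneg_left ?_ (by positivity)
      rcases abs_cases (t * S ω) with ⟨h, _⟩ | ⟨h, _⟩ <;> rw [h]
      · linarith [Real.exp_pos (-t * S ω)]
      · rw [neg_mul]; linarith [Real.exp_pos (t * S ω)]
    have hle : ∫ ω, |t * S ω| ^ r ∂P ≤
        ∫ ω, r ^ r * (Real.exp (t * S ω) + Real.exp (-t * S ω)) ∂P :=
      integral_mono_of_nonneg (Filter.Eventually.of_forall fun ω => by positivity)
        (((hint t).add (hint (-t))).const_mul _) (Filter.Eventually.of_forall hpt)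
    refine hle.trans ?_
    rw [integral_const_mul, integral_add (hint t) (hint (-t)),
      Real.mul_rpow (by norm_num) (by linarith), mul_comm]
    refine mul_le_mul_of_nonneg_right ?_ (by positivity)
    have h1 := hexp t (abs_of_pos ht)
    have h2 := hexp (-t) (by rw [abs_neg, abs_of_pos ht])
    have h3 : (6 : ℝ) ^ (1 : ℝ) ≤ 6 ^ r := Real.rpow_le_rpow_of_exponent_le (by norm_num) hr
    rw [Real.rpow_one] at h3
    linarith [Real.exp_one_lt_d9]
  have hfin := eLpNorm_le_of_integral_rpow_le (hSm.const_mul t) (M := |t| * (N * a)) (fun ω => by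
    rw [abs_mul]; exact mul_le_mul_of_nonneg_left (hSb ω) (abs_nonneg _)) hr (by positivity) hmain
  have hSeq : S = fun ω => (a * √N) * (t * S ω) := by
    funext ω
    rw [ht_def, ← mul_assoc, mul_inv_cancel₀ (by positivity), one_mul]
  have hscale : eLpNorm S (ENNReal.ofReal r) P
      = ENNReal.ofReal (a * √N) * eLpNorm (fun ω => t * S ω) (ENNReal.ofReal r) P := by
    conv_lhs => rw [hSeq]
    have := eLpNorm_const_smul (a * √N) (fun ω => t * S ω) (ENNReal.ofReal r) P
    rw [Real.enorm_of_nonneg (by positivity)] at this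
    exact this
  rw [hscale]
  refine (mul_le_mul_right hfin _).trans ?_
  rw [← ENNReal.ofReal_mul (by positivity)]
  exact le_of_eq (by ring_nf)

end Martingale

/-! ### Local error of a chain with slowly varying transition -/

section ChainError

lemma sum_inv_sqrt_le (n : ℕ) : ∑ p ∈ Finset.range n, (√((p : ℝ) + 1))⁻¹ ≤ 2 * √(n : ℝ) := by
  induction n with
  | zero => simp
  | succ n ih =>
    rw [Finset.sum_range_succ]
    have hn : (0 : ℝ) ≤ n := Nat.cast_nonneg n
    have hs : 0 < √((n : ℝ) + 1) := Real.sqrt_pos.2 (by linarith)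
    have h1 : (√((n : ℝ) + 1))⁻¹ ≤ 2 * (√((n : ℝ) + 1) - √(n : ℝ)) := by
      rw [inv_le_iff_one_le_mul₀ hs]
      nlinarith [Real.sq_sqrt hn, Real.sq_sqrt (by linarith : (0 : ℝ) ≤ n + 1),
        sq_nonneg (√((n : ℝ) + 1) - √(n : ℝ))]
    push_cast
    linarith

lemma eLpNorm_le_ofReal_of_abs_le {Ω : Type*} [MeasurableSpace Ω] {P : Measure Ω}
    [IsProbabilityMeasure P] (p : ℝ≥0∞) {f : Ω → ℝ} {C : ℝ} (h : ∀ ω, |f ω| ≤ C) :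
    eLpNorm f p P ≤ ENNReal.ofReal C := by
  simpa using eLpNorm_le_of_ae_bound (μ := P) (p := p) (f := f) (Filter.Eventually.of_forall h)

/-- A time average of a sequence of functionals splits into a telescoping part, a variation part
and a martingale part. -/
lemma sum_telescope {E : Type*} (g : ℕ → E → ℝ) (y : ℕ → E) (x₀ : E) (n : ℕ) :
    ∑ p ∈ Finset.range n, (g p (y p) - g p (y (p + 1))) =
      (g 0 (y 0) - g 0 x₀) - (g n (y n) - g n x₀) +
        ∑ p ∈ Finset.range n, ((g (p + 1) (y (p + 1)) - g p (y (p + 1))) -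
          (g (p + 1) x₀ - g p x₀)) := by
  induction n with
  | zero => simp
  | succ n ih => rw [Finset.sum_range_succ, ih, Finset.sum_range_succ]; ring

variable {Ω : Type v} {E : Type u} [mE : MeasurableSpace E]

/-- The `σ`-algebra generated by `𝒢` and the chain up to time `p`. -/
abbrev history (𝒢 : MeasurableSpace Ω) (Y : ℕ → Ω → E) (p : ℕ) : MeasurableSpace Ω :=
  𝒢 ⊔ ⨆ q ∈ Finset.range (p + 1), mE.comap (Y q)

lemma history_mono (𝒢 : MeasurableSpace Ω) (Y : ℕ → Ω → E) : Monotone (history 𝒢 Y) :=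
  fun _ _ h => sup_le_sup le_rfl
    (biSup_mono fun _ hq => Finset.range_mono (Nat.succ_le_succ h) hq)

lemma history_le {𝒢 mΩ : MeasurableSpace Ω} (h𝒢 : 𝒢 ≤ mΩ) {Y : ℕ → Ω → E}
    (hY : ∀ n, Measurable (Y n)) (p : ℕ) : history 𝒢 Y p ≤ mΩ :=
  sup_le h𝒢 (iSup₂_le fun q _ => (hY q).comap_le)

lemma measurable_history (𝒢 : MeasurableSpace Ω) (Y : ℕ → Ω → E) {q p : ℕ} (h : q ≤ p) :
    Measurable[history 𝒢 Y p] (Y q) :=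
  measurable_iff_comap_le.2 (le_sup_of_le_right
    (le_iSup₂_of_le q (Finset.mem_range.2 (Nat.lt_succ_of_le h)) le_rfl))

lemma abs_potential_le (L : Kernel E E) [IsMarkovKernel L] {f : E → ℝ} {C : ℝ}
    (hC : ∀ x, |f x| ≤ C) (N : ℕ) (x : E) : |potential L f N x| ≤ N * C :=
  abs_sum_range_le (D := fun k x => act (L ^ k) f x)
    (fun k x => abs_integral_le_of_abs_le ((L ^ k) x) hC) N x

/-- The telescoping, variation and truncation parts of a time average along a path. -/
lemma abs_sum_potential_sub_le {α : Type*} [MeasurableSpace α] (K : Kernel (α × E) E)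
    [IsMarkovKernel K] {π : α → ProbabilityMeasure E}
    (hπ : ∀ a, (K.sectR a).Invariant (π a : Measure E)) {m : ℕ}
    (hm : 1 ≤ m) {b : ℝ} (hb : ∀ a, dobrushin (K.sectR a ^ m) ≤ b) (hb1 : b < 1)
    {c : ℝ} (hc : 0 ≤ c) {u : ℕ → α}
    (hKu : ∀ n x, tvDist (K (u (n + 1), x)) (K (u n, x)) ≤ c * (2 / (n + 2))) (y : ℕ → E)
    {f : E → ℝ} (hf : Measurable f) {D : ℝ} (hosc : OscLe f D) (x₀ : E) (j n : ℕ) :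
    |∑ p ∈ Finset.range (n + 1),
      (potential (K.sectR (u p)) f (j * m) (y p) - potential (K.sectR (u p)) f (j * m) (y (p + 1)) +
        (act (K.sectR (u p) ^ (j * m)) f (y p) - ∫ x, f x ∂(π (u p) : Measure E)))| ≤
      2 * (m / (1 - b) * D) + 8 * c * (m / (1 - b)) ^ 2 * D * √((n : ℝ) + 1) +
        b ^ j * ((n + 1) * D) := by
  have hE : Nonempty E := ⟨x₀⟩
  have hD : 0 ≤ D := hosc.nonneg
  set R : ℝ := m / (1 - b) with hR
  set N := j * m with hN
  set g : α → E → ℝ := fun a => potential (K.sectR a) f N with hg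
  have hgosc : ∀ a, OscLe (g a) (R * D) := fun a => hosc.potential _ hm (hb a) hb1 N hf
  have h1 : |∑ p ∈ Finset.range (n + 1),
      (act (K.sectR (u p) ^ N) f (y p) - ∫ x, f x ∂(π (u p) : Measure E))| ≤
      b ^ j * ((n + 1) * D) := by
    refine (Finset.abs_sum_le_sum_abs _ _).trans ((Finset.sum_le_sum (g := fun _ => b ^ j * D)
      fun p _ => ?_).trans ?_)
    · have := abs_act_pow_sub_integral_le (hπ (u p)) hm (hb _) N hf hosc (y p)
      rwa [hN, Nat.mul_div_cancel _ (by omega)] at this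
    · simp only [Finset.sum_const, Finset.card_range, nsmul_eq_mul]
      push_cast
      linarith
  have h2 := sum_telescope (fun p => g (u p)) y x₀ (n + 1)
  have h3 : |∑ p ∈ Finset.range (n + 1),
      ((g (u (p + 1)) (y (p + 1)) - g (u p) (y (p + 1))) -
        (g (u (p + 1)) x₀ - g (u p) x₀))| ≤ 8 * c * R ^ 2 * D * √((n : ℝ) + 1) := by
    -- The parameter moves by `c * 2 / (p + 2)` at step `p`. The exact sum would be logarithmic;
    -- bounding it by a multiple of `√(n+1)` is enough, since that is the order of the martingale
    -- term.
    refine (Finset.abs_sum_le_sum_abs _ _).trans ((Finset.sum_le_sum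
      (g := fun p : ℕ => 4 * c * R ^ 2 * D * (√((p : ℝ) + 1))⁻¹) fun p _ => ?_).trans ?_)
    · refine (oscLe_potential_sub (K.sectR (u (p + 1))) (K.sectR (u p)) hm (hb _) (hb _)
        hb1 (hKu p) N hf hosc (y (p + 1)) x₀).trans ?_
      have hp : (0 : ℝ) ≤ p := Nat.cast_nonneg p
      have h4 : 1 / ((p : ℝ) + 2) ≤ (√((p : ℝ) + 1))⁻¹ := by
        rw [one_div]
        refine inv_anti₀ (Real.sqrt_pos.2 (by linarith)) ?_
        rw [Real.sqrt_le_left (by linarith)]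
        nlinarith
      have h5 : 0 ≤ 4 * c * R ^ 2 * D := by positivity
      calc _ = 4 * c * R ^ 2 * D * (1 / ((p : ℝ) + 2)) := by ring
        _ ≤ _ := mul_le_mul_of_nonneg_left h4 h5
    · rw [← Finset.mul_sum]
      have h5 : 0 ≤ 4 * c * R ^ 2 * D := by positivity
      have h6 := mul_le_mul_of_nonneg_left (sum_inv_sqrt_le (n + 1)) h5
      push_cast at h6
      linarith
  have h4 := hgosc (u 0) (y 0) x₀
  have h5 := hgosc (u (n + 1)) (y (n + 1)) x₀
  change |∑ p ∈ Finset.range (n + 1), (g (u p) (y p) - g (u p) (y (p + 1)) + _)| ≤ _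
  rw [Finset.sum_add_distrib, h2]
  rw [abs_le] at *
  constructor <;> linarith

/-- The `𝕃_r` deviation of the occupation measures of a chain with a slowly varying mixing
transition `K(U_n, ·)` from the averages of the invariant measures `π(U_n)`. -/
theorem eLpNorm_sum_sub_integral_le (𝒢 : MeasurableSpace Ω) [mΩ : MeasurableSpace Ω]
    {α : Type*} [MeasurableSpace α] {P : Measure Ω} [IsProbabilityMeasure P] (h𝒢 : 𝒢 ≤ mΩ)
    {Y : ℕ → Ω → E} {ν : ProbabilityMeasure E} (K : Kernel (α × E) E) [IsMarkovKernel K]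
    {U : ℕ → Ω → α} (hU : ∀ n, Measurable[𝒢] (U n))
    (hY : @IsMarkovChainGiven Ω mΩ E mE P 𝒢 Y ν (fun n ω x => K (U n ω, x)))
    {π : α → ProbabilityMeasure E} (hπ : ∀ a, (K.sectR a).Invariant (π a : Measure E)) {m : ℕ}
    (hm : 1 ≤ m) {b : ℝ} (hb : ∀ a, dobrushin (K.sectR a ^ m) ≤ b) (hb0 : 0 ≤ b) (hb1 : b < 1)
    {c : ℝ} (hc : 0 ≤ c)
    (hKU : ∀ n ω x, tvDist (K (U (n + 1) ω, x)) (K (U n ω, x)) ≤ c * (2 / (n + 2)))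
    {f : E → ℝ} (hf : Measurable f) {C : ℝ} (hC0 : 0 < C) (hC : ∀ x, |f x| ≤ C)
    {r : ℝ} (hr : 1 ≤ r) (n : ℕ) :
    eLpNorm (fun ω => ∑ p ∈ Finset.range (n + 1),
        (f (Y p ω) - ∫ x, f x ∂(π (U p ω) : Measure E))) (ENNReal.ofReal r) P ≤
      ENNReal.ofReal (16 * r * C * ((1 + c) * (m / (1 - b)) ^ 2) * √((n : ℝ) + 1)) := by
  obtain ⟨x₀⟩ := nonempty_of_isProbabilityMeasure (ν : Measure E)
  have hosc : OscLe f (2 * C) := OscLe.of_bound hC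
  set D : ℝ := 2 * C with hD
  set R : ℝ := m / (1 - b) with hR
  have hm1 : (1 : ℝ) ≤ m := by exact_mod_cast hm
  have hR1 : 1 ≤ R := by
    rw [hR, le_div_iff₀ (by linarith)]; linarith
  have hn : (0 : ℝ) ≤ n := Nat.cast_nonneg n
  have hs1 : 1 ≤ √((n : ℝ) + 1) := Real.one_le_sqrt.2 (by linarith)
  have hYm : ∀ p, Measurable (Y p) := hY.measurable
  have hUm : ∀ p, Measurable (U p) := fun p => (hU p).mono h𝒢 le_rfl
  -- the bound with a remainder of order `b ^ j`
  have hbound : ∀ j : ℕ, eLpNorm (fun ω => ∑ p ∈ Finset.range (n + 1),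
        (f (Y p ω) - ∫ x, f x ∂(π (U p ω) : Measure E))) (ENNReal.ofReal r) P ≤
      ENNReal.ofReal (6 * r * (R * D) * √((n : ℝ) + 1) +
        (2 * (R * D) + 8 * c * R ^ 2 * D * √((n : ℝ) + 1) + b ^ j * ((n + 1) * D))) := by
    intro j
    set N := j * m with hN
    set g : α → E → ℝ := fun a => potential (K.sectR a) f N with hg
    have hgm : Measurable fun p : α × E => g p.1 p.2 := measurable_potential_sectR K hf hosc N
    have hgm' : ∀ a, Measurable (g a) := fun a => measurable_potential _ hf N
    have hgosc : ∀ a, OscLe (g a) (R * D) := fun a => hosc.potential _ hm (hb a) hb1 N hf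
    -- This bound grows with `N` and is used only for integrability; all estimates go through the
    -- oscillation of `g`, which is bounded uniformly in `N`.
    have hgb : ∀ p : α × E, |g p.1 p.2| ≤ N * C := fun p => abs_potential_le _ hC N p.2
    set q : α → E → ℝ := fun a => act (K.sectR a ^ N) f with hq
    set M : ℕ → Ω → ℝ := fun p ω =>
      g (U p ω) (Y (p + 1) ω) - ∫ y, g (U p ω) y ∂(K (U p ω, Y p ω)) with hM
    have hmean : Measurable fun p : α × E => ∫ y, g p.1 y ∂(K p) := by
      have h1 : Measurable fun q : (α × E) × E => g q.1.1 q.2 :=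
        hgm.comp ((measurable_fst.comp measurable_fst).prodMk measurable_snd)
      exact (h1.stronglyMeasurable.integral_kernel_prod_right' (κ := K)).measurable
    have hUh : ∀ {p q : ℕ}, Measurable[history 𝒢 Y p] (U q) :=
      fun {p q} => (hU q).mono le_sup_left le_rfl
    have hMm : ∀ p, Measurable[history 𝒢 Y (p + 1)] (M p) := fun p =>
      (hgm.comp (hUh.prodMk (measurable_history 𝒢 Y le_rfl))).sub
        (hmean.comp (hUh.prodMk (measurable_history 𝒢 Y (Nat.le_succ p))))
    have hMb : ∀ p ω, |M p ω| ≤ R * D := fun p ω =>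
      (hgosc (U p ω)).abs_sub_integral_le _ (hgm' _) _
    have horth : ∀ p (Z : Ω → ℝ), Measurable[history 𝒢 Y p] Z → (∃ C, ∀ ω, |Z ω| ≤ C) →
        ∫ ω, Z ω * M p ω ∂P = 0 := fun p Z hZ ⟨_, hZC⟩ =>
      integral_mul_sub_eq_zero (history_le h𝒢 hYm p) hUh
        (measurable_history 𝒢 Y le_rfl) (hYm (p + 1)) K (hY.transition p) hgm hgb hZ hZC
    have hmart := eLpNorm_sum_le_of_orthogonal (history_le h𝒢 hYm) (history_mono 𝒢 Y) hMm
      (by positivity) hMb horth hr (Nat.succ_pos n)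
    set Q : Ω → ℝ := fun ω => ∑ p ∈ Finset.range (n + 1),
      (g (U p ω) (Y p ω) - g (U p ω) (Y (p + 1) ω) +
        (q (U p ω) (Y p ω) - ∫ x, f x ∂(π (U p ω) : Measure E))) with hQ
    -- The Poisson equation replaces `f` by `g - K g + q`, and adding and subtracting `g` at the
    -- next state isolates the martingale increment.
    have hsplit : (fun ω => ∑ p ∈ Finset.range (n + 1),
        (f (Y p ω) - ∫ x, f x ∂(π (U p ω) : Measure E))) =
        (fun ω => ∑ p ∈ Finset.range (n + 1), M p ω) + fun ω => Q ω := by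
      funext ω
      rw [Pi.add_apply, hQ]
      dsimp only
      rw [← Finset.sum_add_distrib]
      refine Finset.sum_congr rfl fun p _ => ?_
      have h1 : ∫ y, g (U p ω) y ∂(K (U p ω, Y p ω)) =
          g (U p ω) (Y p ω) + q (U p ω) (Y p ω) - f (Y p ω) :=
        act_potential (K.sectR (U p ω)) hf hosc N (Y p ω)
      simp only [hM]
      rw [h1]
      ring
    have hQb : ∀ ω, |Q ω| ≤
        2 * (R * D) + 8 * c * R ^ 2 * D * √((n : ℝ) + 1) + b ^ j * ((n + 1) * D) := fun ω =>
      abs_sum_potential_sub_le K hπ hm hb hb1 hc (fun p => hKU p ω) (fun p => Y p ω) hf hosc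
        x₀ j n
    have hqm : Measurable fun p : α × E => q p.1 p.2 := measurable_act_sectR_pow K hf hosc N
    have hE : Nonempty E := ⟨x₀⟩
    have hπf : Measurable fun a => ∫ x, f x ∂(π a : Measure E) :=
      measurable_integral_probabilityMeasure (measurable_of_invariant K hπ hm hb hb1) hf
    have h1 : ∀ p, Measurable fun ω => g (U p ω) (Y p ω) :=
      fun p => by have h := hgm.comp ((hUm p).prodMk (hYm p)); exact h
    have h2 : ∀ p, Measurable fun ω => g (U p ω) (Y (p + 1) ω) :=
      fun p => by have h := hgm.comp ((hUm p).prodMk (hYm (p + 1))); exact h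
    have h3 : ∀ p, Measurable fun ω => q (U p ω) (Y p ω) :=
      fun p => by have h := hqm.comp ((hUm p).prodMk (hYm p)); exact h
    have h4 : ∀ p, Measurable fun ω => ∫ x, f x ∂(π (U p ω) : Measure E) :=
      fun p => hπf.comp (hUm p)
    have hQm : Measurable Q := Finset.measurable_fun_sum _ fun p _ =>
      ((h1 p).sub (h2 p)).add ((h3 p).sub (h4 p))
    rw [hsplit]
    have hSm : Measurable fun ω => ∑ p ∈ Finset.range (n + 1), M p ω :=
      Finset.measurable_fun_sum _ fun p _ => (hMm p).mono (history_le h𝒢 hYm _) le_rfl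
    have hr1 : 1 ≤ ENNReal.ofReal r := by simpa using hr
    refine (eLpNorm_add_le hSm.aestronglyMeasurable hQm.aestronglyMeasurable hr1).trans ?_
    rw [ENNReal.ofReal_add (by positivity) (by positivity)]
    refine add_le_add ?_ (eLpNorm_le_ofReal_of_abs_le _ hQb)
    rwa [Nat.cast_succ] at hmart
  -- The quantity to bound does not involve `j`, so the truncation can be removed at fixed `n`.
  have hlim : Filter.Tendsto (fun j : ℕ => ENNReal.ofReal (6 * r * (R * D) * √((n : ℝ) + 1) +
        (2 * (R * D) + 8 * c * R ^ 2 * D * √((n : ℝ) + 1) + b ^ j * ((n + 1) * D))))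
      Filter.atTop (nhds (ENNReal.ofReal (6 * r * (R * D) * √((n : ℝ) + 1) +
        (2 * (R * D) + 8 * c * R ^ 2 * D * √((n : ℝ) + 1) + 0 * ((n + 1) * D))))) :=
    ENNReal.tendsto_ofReal (tendsto_const_nhds.add (tendsto_const_nhds.add
      ((tendsto_pow_atTop_nhds_zero_of_lt_one hb0 hb1).mul_const _)))
  refine (ge_of_tendsto' hlim hbound).trans (ENNReal.ofReal_le_ofReal ?_)
  have hRR : R ≤ R ^ 2 := by nlinarith
  have hDs : 0 ≤ D * √((n : ℝ) + 1) := by positivity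
  have e1 : 6 * r * (R * D) * √((n : ℝ) + 1) ≤ 6 * r * R ^ 2 * (D * √((n : ℝ) + 1)) := by
    have := mul_le_mul_of_nonneg_right (mul_le_mul_of_nonneg_left hRR (by positivity : 0 ≤ 6 * r))
      hDs
    linarith
  have e2 : 2 * (R * D) ≤ 2 * r * R ^ 2 * (D * √((n : ℝ) + 1)) := by
    have h1 : R ≤ r * R ^ 2 := hRR.trans (le_mul_of_one_le_left (by positivity) hr)
    have h2 : D ≤ D * √((n : ℝ) + 1) := le_mul_of_one_le_right (by positivity) hs1
    have := mul_le_mul h1 h2 (by positivity) (by positivity)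
    linarith
  have e3 : 8 * c * R ^ 2 * D * √((n : ℝ) + 1) ≤ 8 * r * c * R ^ 2 * (D * √((n : ℝ) + 1)) := by
    have := le_mul_of_one_le_left (by positivity : 0 ≤ 8 * c * R ^ 2 * (D * √((n : ℝ) + 1))) hr
    linarith
  -- The martingale gives `6`, the boundary terms `2` and the drift `8 c`; then `D = 2 C` turns `8`
  -- into `16`. Raising `R` to `R²` uses `R ≥ 1`.
  calc _ ≤ 8 * r * ((1 + c) * R ^ 2) * (D * √((n : ℝ) + 1)) := by linarith
    _ = _ := by rw [hD]; ring

end ChainError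

/-! ### Minkowski's integral inequality and averages of flows -/

section Transfer

lemma rpow_lintegral_le {ι : Type*} [MeasurableSpace ι] (ρ : Measure ι) [IsFiniteMeasure ρ]
    {ψ : ι → ℝ≥0∞} (hψ : Measurable ψ) {r : ℝ} (hr : 1 ≤ r) :
    (∫⁻ i, ψ i ∂ρ) ^ r ≤ ρ Set.univ ^ (r - 1) * ∫⁻ i, ψ i ^ r ∂ρ := by
  have hr0 : 0 < r := by linarith
  rcases hr.eq_or_lt with rfl | hr1
  · simp
  have hpq : r.HolderConjugate (r / (r - 1)) := Real.HolderConjugate.conjExponent hr1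
  have h := ENNReal.lintegral_mul_le_Lp_mul_Lq ρ hpq hψ.aemeasurable
    (aemeasurable_const (b := (1 : ℝ≥0∞)))
  simp only [Pi.mul_apply, mul_one, ENNReal.one_rpow, lintegral_const, one_mul] at h
  have h2 := ENNReal.rpow_le_rpow h hr0.le
  rw [ENNReal.mul_rpow_of_nonneg _ _ hr0.le, ← ENNReal.rpow_mul, ← ENNReal.rpow_mul] at h2
  rw [one_div_mul_cancel hr0.ne', ENNReal.rpow_one, mul_comm] at h2
  convert h2 using 3
  have : r - 1 ≠ 0 := by linarith
  field_simp

variable {Ω : Type v} [mΩ : MeasurableSpace Ω] {E : Type u} [MeasurableSpace E]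

lemma measurable_diffInt_flow {ι : Type*} [MeasurableSpace ι] {η μ : Ω → ProbabilityMeasure E}
    (hη : Measurable η) (hμ : Measurable μ) {g : ι → E → ℝ} (hg : Measurable (Function.uncurry g)) :
    Measurable fun p : Ω × ι => diffInt (η p.1 : Measure E) (μ p.1) (g p.2) := by
  have key : ∀ {ξ : Ω → ProbabilityMeasure E}, Measurable ξ →
      Measurable fun p : Ω × ι => ∫ x, g p.2 x ∂(ξ p.1 : Measure E) := by
    intro ξ hξ
    let κ : Kernel (Ω × ι) E :=
      ⟨fun p => (ξ p.1 : Measure E), measurable_subtype_coe.comp (hξ.comp measurable_fst)⟩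
    have : IsMarkovKernel κ := ⟨fun p => (ξ p.1).2⟩
    have h1 : Measurable fun q : (Ω × ι) × E => g q.1.2 q.2 :=
      hg.comp ((measurable_snd.comp measurable_fst).prodMk measurable_snd)
    exact (h1.stronglyMeasurable.integral_kernel_prod_right' (κ := κ)).measurable
  exact (key hη).sub (key hμ)

lemma measurable_diffInt {η μ : Ω → ProbabilityMeasure E}
    (hη : Measurable η) (hμ : Measurable μ) {g : E → ℝ} (hg : Measurable g) :
    Measurable fun ω => diffInt (η ω : Measure E) (μ ω) g :=
  (measurable_integral_probabilityMeasure hη hg).sub (measurable_integral_probabilityMeasure hμ hg)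

lemma supNorm_nonneg {E : Type*} (f : E → ℝ) : 0 ≤ supNorm f :=
  Real.iSup_nonneg fun _ => abs_nonneg _

lemma abs_le_supNorm {E : Type*} {f : E → ℝ} (h : ∃ C : ℝ, ∀ x, |f x| ≤ C) (x : E) :
    |f x| ≤ supNorm f :=
  le_ciSup (f := fun x => |f x|) (h.imp fun _ hC => Set.forall_mem_range.2 hC) x

lemma rpow_sub_one_mul_rpow_mul {x a : ℝ≥0∞} (hx : x ≠ ∞) {r : ℝ} (hr : 1 ≤ r) :
    x ^ (r - 1) * (a ^ r * x) = (x * a) ^ r := by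
  have hr0 : 0 < r := by linarith
  rw [ENNReal.mul_rpow_of_nonneg _ _ hr0.le]
  rcases eq_or_ne x 0 with h0 | h0
  · rw [h0, ENNReal.zero_rpow_of_pos hr0]; simp
  · rw [mul_comm (a ^ r), ← mul_assoc]
    congr 1
    nth_rewrite 2 [← ENNReal.rpow_one x]
    rw [← ENNReal.rpow_add _ _ h0 hx]
    congr 1
    ring

/-- Minkowski's integral inequality for a family `φ(·, i)` with `𝕃_r` norms at most `a w(i)`. -/
lemma lintegral_rpow_lintegral_le {P : Measure Ω} [IsProbabilityMeasure P] {ι : Type*}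
    [MeasurableSpace ι] (m : Measure ι) {w : ι → ℝ≥0∞} (hw : AEMeasurable w m)
    (hwtop : ∀ i, w i ≠ ∞) {L : ℝ≥0∞} (hL : ∫⁻ i, w i ∂m ≤ L) (hL' : L ≠ ∞)
    {φ : Ω → ι → ℝ≥0∞} (hφ : Measurable (Function.uncurry φ))
    (hφ0 : ∀ ω i, w i = 0 → φ ω i = 0) {r : ℝ} (hr : 1 ≤ r) {a : ℝ≥0∞}
    (h : ∀ i, ∫⁻ ω, φ ω i ^ r ∂P ≤ (w i * a) ^ r) :
    ∫⁻ ω, (∫⁻ i, φ ω i ∂m) ^ r ∂P ≤ (L * a) ^ r := by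
  have hr0 : 0 < r := by linarith
  obtain ⟨w', hw'm, hae⟩ := hw
  have hww : ∀ᵐ i ∂m, w' i = w i := hae.mono fun i hi => hi.symm
  -- Under `ρ = w dm`, of mass at most `L`, the ratios `φ / w` have `𝕃_r` norm at most `a`, and
  -- Hölder's inequality followed by Tonelli concludes. Since `ρ` is finite, Tonelli applies even if
  -- `m` is not σ-finite.
  obtain ⟨ρ, hρ⟩ : ∃ ρ, ρ = m.withDensity w' := ⟨_, rfl⟩
  have hρu : ρ Set.univ ≤ L := by
    rw [hρ, withDensity_apply _ MeasurableSet.univ, Measure.restrict_univ]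
    exact (lintegral_congr_ae hww).le.trans hL
  have : IsFiniteMeasure ρ := ⟨hρu.trans_lt hL'.lt_top⟩
  have hφω : ∀ ω, Measurable fun i => φ ω i := fun ω => hφ.comp measurable_prodMk_left
  have hφi : ∀ i, Measurable fun ω => φ ω i := fun i => hφ.comp measurable_prodMk_right
  have hψm : Measurable (Function.uncurry fun ω i => (φ ω i / w' i) ^ r) :=
    (hφ.div (hw'm.comp measurable_snd)).pow_const r
  have hint : ∀ ω, ∫⁻ i, φ ω i ∂m = ∫⁻ i, φ ω i / w' i ∂ρ := by
    intro ω
    have hψω : Measurable fun i => φ ω i / w' i := (hφω ω).div hw'm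
    rw [hρ, lintegral_withDensity_eq_lintegral_mul _ hw'm hψω]
    refine lintegral_congr_ae (hww.mono fun i hi => ?_)
    simp only [Pi.mul_apply]
    -- Dividing by the weight loses nothing, because `φ` vanishes where the weight does.
    rcases eq_or_ne (w' i) 0 with h0 | h0
    · simp [h0, hφ0 ω i (hi.symm.trans h0)]
    · rw [ENNReal.mul_div_cancel h0 (hi ▸ hwtop i)]
  have hne : ∀ᵐ i ∂ρ, w' i ≠ 0 := by
    rw [hρ, ae_withDensity_iff hw'm]
    exact Filter.Eventually.of_forall fun i hi => hi
  have hww' : ∀ᵐ i ∂ρ, w' i = w i := by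
    rw [hρ]
    exact (withDensity_absolutelyContinuous _ _).ae_le hww
  have hle : ∀ᵐ i ∂ρ, ∫⁻ ω, (φ ω i / w' i) ^ r ∂P ≤ a ^ r := by
    filter_upwards [hne, hww'] with i h0 hi
    simp only [ENNReal.div_rpow_of_nonneg _ _ hr0.le]
    simp only [div_eq_mul_inv]
    rw [lintegral_mul_const _ ((hφi i).pow_const r), ← div_eq_mul_inv]
    refine ENNReal.div_le_of_le_mul ((h i).trans ?_)
    rw [← hi, ENNReal.mul_rpow_of_nonneg _ _ hr0.le, mul_comm]
  calc ∫⁻ ω, (∫⁻ i, φ ω i ∂m) ^ r ∂P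
      ≤ ∫⁻ ω, ρ Set.univ ^ (r - 1) * ∫⁻ i, (φ ω i / w' i) ^ r ∂ρ ∂P := by
        refine lintegral_mono fun ω => ?_
        rw [hint]
        exact rpow_lintegral_le ρ ((hφω ω).div hw'm) hr
    _ = ρ Set.univ ^ (r - 1) * ∫⁻ ω, ∫⁻ i, (φ ω i / w' i) ^ r ∂ρ ∂P :=
        lintegral_const_mul _ hψm.lintegral_prod_right'
    _ = ρ Set.univ ^ (r - 1) * ∫⁻ i, ∫⁻ ω, (φ ω i / w' i) ^ r ∂P ∂ρ := by
        rw [lintegral_lintegral_swap hψm.aemeasurable]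
    _ ≤ ρ Set.univ ^ (r - 1) * ∫⁻ _, a ^ r ∂ρ := mul_le_mul_right (lintegral_mono_ae hle) _
    _ = (ρ Set.univ * a) ^ r := by
        rw [lintegral_const, rpow_sub_one_mul_rpow_mul (measure_ne_top _ _) hr]
    _ ≤ (L * a) ^ r := by gcongr

/-- Minkowski's inequality for the integral over `Γ(dg)`, when the `𝕃_r` norm of `[η - μ](g)` is
at most `a ‖g‖`. -/
lemma lintegral_rpow_lint_le {P : Measure Ω} [IsProbabilityMeasure P] (Γ : FunMeasure.{u, w} E)
    {L : ℝ≥0∞} (hL : Γ.lint supNorm ≤ L) (hL' : L ≠ ∞) {η μ : Ω → ProbabilityMeasure E}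
    (hη : Measurable η) (hμ : Measurable μ) {r : ℝ} (hr : 1 ≤ r) {a : ℝ≥0∞}
    (h : ∀ g : E → ℝ, Measurable g → ∀ C : ℝ, 0 ≤ C → (∀ x, |g x| ≤ C) →
      ∫⁻ ω, ENNReal.ofReal |diffInt (η ω : Measure E) (μ ω) g| ^ r ∂P ≤
        (ENNReal.ofReal C * a) ^ r) :
    ∫⁻ ω, (Γ.lint fun g => |diffInt (η ω : Measure E) (μ ω) g|) ^ r ∂P ≤ (L * a) ^ r := by
  refine lintegral_rpow_lintegral_le Γ.law Γ.measurable_norm.ennreal_ofReal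
    (fun _ => ENNReal.ofReal_ne_top) hL hL'
    (φ := fun ω i => ENNReal.ofReal |diffInt (η ω : Measure E) (μ ω) (Γ.fn i)|)
    (measurable_norm.comp (measurable_diffInt_flow hη hμ Γ.measurable_fn)).ennreal_ofReal
    (fun ω i h0 => ?_) hr fun i => h _ (Γ.measurable_fn.comp measurable_prodMk_left) _
      (supNorm_nonneg _) (abs_le_supNorm (Γ.bounded_fn i))
  have h1 : supNorm (Γ.fn i) ≤ 0 := ENNReal.ofReal_eq_zero.1 h0
  have h2 := abs_diffInt_le_two (η ω : Measure E) (μ ω) (abs_le_supNorm (Γ.bounded_fn i))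
  exact ENNReal.ofReal_eq_zero.2 (by linarith)

lemma eLpNorm_ofReal_eq {P : Measure Ω} {f : Ω → ℝ} {r : ℝ} (hr : 1 ≤ r) :
    eLpNorm f (ENNReal.ofReal r) P = (∫⁻ ω, ENNReal.ofReal |f ω| ^ r ∂P) ^ (1 / r) := by
  have hr0 : 0 < r := by linarith
  rw [eLpNorm_eq_lintegral_rpow_enorm_toReal (by simpa using hr0) ENNReal.ofReal_ne_top,
    ENNReal.toReal_ofReal hr0.le]
  simp only [Real.enorm_eq_ofReal_abs]

lemma eLpNorm_ofReal_le_iff {P : Measure Ω} {f : Ω → ℝ} {r : ℝ} (hr : 1 ≤ r) {a : ℝ≥0∞} :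
    eLpNorm f (ENNReal.ofReal r) P ≤ a ↔ ∫⁻ ω, ENNReal.ofReal |f ω| ^ r ∂P ≤ a ^ r := by
  have hr0 : 0 < r := by linarith
  rw [eLpNorm_ofReal_eq hr, one_div, ENNReal.rpow_inv_le_iff hr0]

lemma coe_average (η : ℕ → ProbabilityMeasure E) (n : ℕ) : (average η n : Measure E) =
    ((n : ℝ≥0∞) + 1)⁻¹ • ∑ p ∈ Finset.range (n + 1), (η p : Measure E) := rfl

lemma integral_average (η : ℕ → ProbabilityMeasure E) (n : ℕ) {f : E → ℝ} (hf : Measurable f)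
    {C : ℝ} (hC : ∀ x, |f x| ≤ C) : ∫ x, f x ∂(average η n : Measure E) =
      ((n : ℝ) + 1)⁻¹ * ∑ p ∈ Finset.range (n + 1), ∫ x, f x ∂(η p : Measure E) := by
  rw [coe_average, integral_smul_measure, integral_finsetSum_measure
    fun p _ => integrable_of_abs_le _ hf hC, smul_eq_mul]
  congr 1
  rw [ENNReal.toReal_inv, ENNReal.toReal_add (by simp) (by simp)]
  simp

lemma diffInt_average (η μ : ℕ → ProbabilityMeasure E) (n : ℕ) {f : E → ℝ} (hf : Measurable f)
    {C : ℝ} (hC : ∀ x, |f x| ≤ C) : diffInt (average η n : Measure E) (average μ n) f =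
      ((n : ℝ) + 1)⁻¹ * ∑ p ∈ Finset.range (n + 1), diffInt (η p : Measure E) (μ p) f := by
  simp only [diffInt]
  rw [integral_average η n hf hC, integral_average μ n hf hC, ← mul_sub, Finset.sum_sub_distrib]

lemma average_const (μ : ProbabilityMeasure E) : average (fun _ => μ) = fun _ => μ := by
  funext n
  refine Subtype.ext ?_
  change (average (fun _ => μ) n : Measure E) = μ
  rw [coe_average, Finset.sum_const, Finset.card_range, ← Nat.cast_smul_eq_nsmul ℝ≥0∞, smul_smul]
  push_cast
  rw [ENNReal.inv_mul_cancel (by simp) (by simp), one_smul]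

lemma measurable_average {η : Ω → ℕ → ProbabilityMeasure E} (hη : ∀ p, Measurable fun ω => η ω p)
    (n : ℕ) : Measurable fun ω => average (η ω) n := by
  have h : Measurable fun ω => (average (η ω) n : Measure E) := by
    refine Measure.measurable_of_measurable_coe _ fun A hA => ?_
    simp only [coe_average, Measure.smul_apply, Measure.finsetSum_apply, smul_eq_mul]
    refine Measurable.const_mul (Finset.measurable_fun_sum _ fun p _ => ?_) _
    exact (Measure.measurable_coe hA).comp (measurable_subtype_coe.comp (hη p))
  exact h.subtype_mk

lemma measurable_diracProba : Measurable fun x : E => diracProba x :=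
  Measure.measurable_dirac.subtype_mk

lemma measurable_occupation {Y : ℕ → Ω → E} (hY : ∀ n, Measurable (Y n)) (n : ℕ) :
    Measurable fun ω => occupation (fun p => Y p ω) n :=
  measurable_average (fun p => measurable_diracProba.comp (hY p)) n

lemma integral_occupation (x : ℕ → E) (n : ℕ) {f : E → ℝ} (hf : Measurable f)
    {C : ℝ} (hC : ∀ x, |f x| ≤ C) : ∫ y, f y ∂(occupation x n : Measure E) =
      ((n : ℝ) + 1)⁻¹ * ∑ p ∈ Finset.range (n + 1), f (x p) := by
  rw [occupation, integral_average _ n hf hC]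
  congr 1
  refine Finset.sum_congr rfl fun p _ => ?_
  exact integral_dirac' _ _ hf.stronglyMeasurable

/-- The new occupation measure is a mixture of the old one and a Dirac mass of weight `1 / (n + 2)`.
This is the source of the slow drift of the transitions. -/
lemma tvDist_occupation_succ_le (x : ℕ → E) (n : ℕ) :
    tvDist (occupation x (n + 1) : Measure E) (occupation x n) ≤ 2 / (n + 2) := by
  refine tvDist_le_of_forall fun f hf hf1 => ?_
  have hn : (0 : ℝ) ≤ n := Nat.cast_nonneg n
  have h0 : diffInt (occupation x (n + 1) : Measure E) (occupation x n) f =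
      ((n : ℝ) + 2)⁻¹ * (f (x (n + 1)) - ∫ y, f y ∂(occupation x n : Measure E)) := by
    simp only [diffInt]
    rw [integral_occupation x (n + 1) hf hf1, integral_occupation x n hf hf1,
      Finset.sum_range_succ]
    push_cast
    have h1 : (n : ℝ) + 1 ≠ 0 := by positivity
    have h2 : (n : ℝ) + 2 ≠ 0 := by positivity
    have h3 : (n : ℝ) + 1 + 1 ≠ 0 := by positivity
    field_simp
    ring
  rw [h0, abs_mul, abs_of_nonneg (by positivity), div_eq_inv_mul]
  refine mul_le_mul_of_nonneg_left ?_ (by positivity)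
  have := (OscLe.of_bound hf1).abs_sub_integral_le (occupation x n : Measure E) hf (x (n + 1))
  simpa using this

/-- The random flows `η` and `μ` are at distance at most `D / √(n+1)` at time `n`, in `𝕃_r` norm
and uniformly over functions bounded by one. -/
def FlowClose (P : Measure Ω) (r : ℝ) (η μ : Ω → ℕ → ProbabilityMeasure E) (D : ℝ) : Prop :=
  ∀ n (f : E → ℝ), Measurable f → ∀ C : ℝ, 0 ≤ C → (∀ x, |f x| ≤ C) →
    eLpNorm (fun ω => diffInt (η ω n : Measure E) (μ ω n) f) (ENNReal.ofReal r) P ≤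
      ENNReal.ofReal (C * (D / √((n : ℝ) + 1)))

lemma FlowClose.trans {P : Measure Ω} {r : ℝ} (hr : 1 ≤ r) {η μ ξ : Ω → ℕ → ProbabilityMeasure E}
    (hη : ∀ n, Measurable fun ω => η ω n) (hμ : ∀ n, Measurable fun ω => μ ω n)
    (hξ : ∀ n, Measurable fun ω => ξ ω n) {D D' : ℝ} (hD : 0 ≤ D) (hD' : 0 ≤ D')
    (h : FlowClose P r η μ D) (h' : FlowClose P r μ ξ D') : FlowClose P r η ξ (D + D') := by
  intro n f hf C hC hfC
  have hsplit : (fun ω => diffInt (η ω n : Measure E) (ξ ω n) f) =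
      (fun ω => diffInt (η ω n : Measure E) (μ ω n) f) +
        fun ω => diffInt (μ ω n : Measure E) (ξ ω n) f := by
    funext ω
    simp [diffInt]
  rw [hsplit, add_div, mul_add, ENNReal.ofReal_add (by positivity) (by positivity)]
  refine (eLpNorm_add_le (measurable_diffInt (hη n) (hμ n) hf).aestronglyMeasurable
    (measurable_diffInt (hμ n) (hξ n) hf).aestronglyMeasurable (by simpa using hr)).trans ?_
  exact add_le_add (h n f hf C hC hfC) (h' n f hf C hC hfC)

lemma FlowClose.mono {P : Measure Ω} {r : ℝ} {η μ : Ω → ℕ → ProbabilityMeasure E}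
    {D D' : ℝ} (h : FlowClose P r η μ D) (hD : D ≤ D') : FlowClose P r η μ D' := by
  intro n f hf C hC hfC
  refine (h n f hf C hC hfC).trans (ENNReal.ofReal_le_ofReal ?_)
  gcongr

end Transfer

/-! ### Propagation of errors through the time averaged transformation -/

section FlowMap

variable {Ω : Type v} [mΩ : MeasurableSpace Ω] {S : ℕ → Type u} [∀ l, MeasurableSpace (S l)]
  {𝓜 : Model S}

lemma measurable_Φbar {l : ℕ} (hΦ : Measurable (𝓜.Φ l)) {η : Ω → ℕ → ProbabilityMeasure (S l)}
    (hη : ∀ n, Measurable fun ω => η ω n) (n : ℕ) : Measurable fun ω => 𝓜.Φbar l (η ω) n :=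
  measurable_average (fun p => hΦ.comp (hη p)) n

/-- At each time Minkowski's inequality under `Γ` yields the factor `Λ`. The factor `2` comes from
averaging in time: the mean of `1 / √(p+1)` over `p ≤ n` is at most `2 / √(n+1)`. -/
lemma FlowClose.Φbar {P : Measure Ω} [IsProbabilityMeasure P] {r : ℝ} (hr : 1 ≤ r) {l : ℕ}
    (hΦ : Measurable (𝓜.Φ l)) {η μ : Ω → ℕ → ProbabilityMeasure (S l)}
    (hη : ∀ n, Measurable fun ω => η ω n) (hμ : ∀ n, Measurable fun ω => μ ω n)
    {Γ : ∀ l, BddMeas (S (l + 1)) → FunMeasure.{u, w} (S l)} {Λ : ℕ → ℝ≥0}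
    (hW : 𝓜.WeakLipschitz Γ Λ) {D : ℝ} (hD : 0 ≤ D) (h : FlowClose P r η μ D) :
    FlowClose P r (fun ω => 𝓜.Φbar l (η ω)) (fun ω => 𝓜.Φbar l (μ ω)) (2 * Λ (l + 1) * D) := by
  intro n f hf C hC hfC
  have hr0 : 0 < r := by linarith
  obtain ⟨hW1, hW2⟩ := hW l ⟨f, hf, C, hfC⟩
  have hsup : supNorm f ≤ C := Real.iSup_le hfC hC
  have hL : (Γ l ⟨f, hf, C, hfC⟩).lint supNorm ≤ ENNReal.ofReal (Λ (l + 1) * C) := by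
    refine hW2.trans ?_
    rw [ENNReal.ofReal_mul (NNReal.coe_nonneg _), ENNReal.ofReal_coe_nnreal]
    gcongr
  have hp : ∀ p : ℕ, eLpNorm (fun ω => diffInt (𝓜.Φ l (η ω p) : Measure (S (l + 1)))
      (𝓜.Φ l (μ ω p)) f) (ENNReal.ofReal r) P ≤
        ENNReal.ofReal (Λ (l + 1) * C * (D / √((p : ℝ) + 1))) := by
    intro p
    rw [eLpNorm_ofReal_le_iff hr]
    refine (lintegral_mono fun ω => ENNReal.rpow_le_rpow (hW1 (η ω p) (μ ω p)) hr0.le).trans ?_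
    rw [ENNReal.ofReal_mul (by positivity)]
    refine lintegral_rpow_lint_le _ hL ENNReal.ofReal_ne_top (hη p) (hμ p) hr
      fun g hg C' hC' hgC => ?_
    rw [← eLpNorm_ofReal_le_iff hr, ← ENNReal.ofReal_mul hC']
    exact h p g hg C' hC' hgC
  have hsplit : (fun ω => diffInt (𝓜.Φbar l (η ω) n : Measure (S (l + 1))) (𝓜.Φbar l (μ ω) n) f) =
      ((n : ℝ) + 1)⁻¹ • ∑ p ∈ Finset.range (n + 1),
        fun ω => diffInt (𝓜.Φ l (η ω p) : Measure (S (l + 1))) (𝓜.Φ l (μ ω p)) f := by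
    funext ω
    simp only [Pi.smul_apply, Finset.sum_apply, smul_eq_mul]
    exact diffInt_average _ _ n hf hfC
  have hn : (0 : ℝ) < n + 1 := by positivity
  rw [hsplit, eLpNorm_const_smul, Real.enorm_of_nonneg (by positivity)]
  refine (mul_le_mul_right ((eLpNorm_sum_le (fun p _ =>
    (measurable_diffInt (hΦ.comp (hη p)) (hΦ.comp (hμ p)) hf).aestronglyMeasurable)
    (by simpa using hr)).trans (Finset.sum_le_sum fun p _ => hp p)) _).trans ?_
  rw [← ENNReal.ofReal_sum_of_nonneg (fun p _ => by positivity),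
    ← ENNReal.ofReal_mul (by positivity)]
  refine ENNReal.ofReal_le_ofReal ?_
  have h1 : ∑ p ∈ Finset.range (n + 1), (Λ (l + 1) : ℝ) * C * (D / √((p : ℝ) + 1)) =
      Λ (l + 1) * C * D * ∑ p ∈ Finset.range (n + 1), (√((p : ℝ) + 1))⁻¹ := by
    rw [Finset.mul_sum]
    exact Finset.sum_congr rfl fun p _ => by ring
  have h2 := sum_inv_sqrt_le (n + 1)
  push_cast at h2
  rw [h1]
  calc _ ≤ ((n : ℝ) + 1)⁻¹ * (Λ (l + 1) * C * D * (2 * √((n : ℝ) + 1))) := by gcongr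
    _ = C * (2 * Λ (l + 1) * D / √((n : ℝ) + 1)) := by
      have hs : √((n : ℝ) + 1) * √((n : ℝ) + 1) = n + 1 := Real.mul_self_sqrt hn.le
      have hs0 : 0 < √((n : ℝ) + 1) := Real.sqrt_pos.2 hn
      have hi : ((n : ℝ) + 1)⁻¹ = (√((n : ℝ) + 1))⁻¹ * (√((n : ℝ) + 1))⁻¹ := by
        rw [← mul_inv, hs]
      rw [hi]
      field_simp

end FlowMap

/-! ### Local errors in the model -/

section Levels

/-- The zeroth power is the identity, which preserves oscillations; if it also contracts them
strictly, they all vanish. This settles the degenerate mixing exponent `0`. -/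
lemma oscLe_zero_of_dobrushin_pow_zero {E : Type u} [MeasurableSpace E] {L : Kernel E E}
    [IsMarkovKernel L] (hL : dobrushin (L ^ 0) < 1) {f : E → ℝ} {D : ℝ} (hf : Measurable f)
    (h : OscLe f D) : OscLe f 0 := by
  have hk : ∀ k : ℕ, OscLe f (dobrushin (L ^ 0) ^ k * D) := by
    intro k
    induction k with
    | zero => simpa using h
    | succ k ih =>
      have := ih.act_dobrushin (L ^ 0) hf
      rwa [act_pow_zero L hf, ← mul_assoc, ← pow_succ'] at this
  intro x y
  have hlim := (tendsto_pow_atTop_nhds_zero_of_lt_one (dobrushin_nonneg (L ^ 0)) hL).mul_const D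
  rw [zero_mul] at hlim
  exact ge_of_tendsto' hlim fun k => hk k x y

lemma exists_mixing {α : Type*} {E : Type u} [MeasurableSpace E] {L : α → Kernel E E}
    [∀ a, IsMarkovKernel (L a)] {n₀ : ℕ} {b : ℝ} (hb : ∀ a, dobrushin (L a ^ n₀) ≤ b)
    (hb1 : b < 1) : ∃ m, 1 ≤ m ∧ ∃ b' : ℝ, b' < 1 ∧ ∀ a, dobrushin (L a ^ m) ≤ b' := by
  rcases Nat.eq_zero_or_pos n₀ with rfl | hn
  · refine ⟨1, le_rfl, 0, zero_lt_one, fun a => Real.iSup_le (fun f => ?_) le_rfl⟩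
    have h := oscLe_zero_of_dobrushin_pow_zero ((hb a).trans_lt hb1) f.2.1 (D := 1) f.2.2
    exact osc_le_of_oscLe le_rfl (h.act (L a ^ 1) f.2.1)
  · exact ⟨n₀, hn, b, hb1, hb⟩

variable {Ω : Type v}

/-- The occupation measures of a chain with a slowly varying mixing transition are close to the
averages of the corresponding invariant measures. -/
theorem flowClose_occupation (𝒢 : MeasurableSpace Ω) [mΩ : MeasurableSpace Ω] {E : Type u}
    [mE : MeasurableSpace E] {α : Type*} [MeasurableSpace α]
    {P : Measure Ω} [IsProbabilityMeasure P] (h𝒢 : 𝒢 ≤ mΩ)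
    {Y : ℕ → Ω → E} {ν : ProbabilityMeasure E} (K : Kernel (α × E) E) [IsMarkovKernel K]
    {U : ℕ → Ω → α} (hU : ∀ n, Measurable[𝒢] (U n))
    (hY : @IsMarkovChainGiven Ω mΩ E mE P 𝒢 Y ν (fun n ω x => K (U n ω, x)))
    {π : α → ProbabilityMeasure E} (hπ : ∀ a, (K.sectR a).Invariant (π a : Measure E)) {m : ℕ}
    {b : ℝ} (hb : ∀ a, dobrushin (K.sectR a ^ m) ≤ b) (hb0 : 0 ≤ b) (hb1 : b < 1)
    {c : ℝ} (hc : 0 ≤ c)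
    (hKU : ∀ n ω x, tvDist (K (U (n + 1) ω, x)) (K (U n ω, x)) ≤ c * (2 / (n + 2)))
    {r : ℝ} (hr : 1 ≤ r) {A : ℝ} (hA : (1 + c) * (m / (1 - b)) ^ 2 ≤ A) :
    FlowClose P r (fun ω => occupation fun p => Y p ω)
      (fun ω => average fun p => π (U p ω)) (16 * r * A) := by
  intro n f hf C hC hfC
  have hA0 : 0 ≤ A := le_trans (by positivity) hA
  -- For `m = 0` the constant `A` may be zero, so the error itself has to vanish; it does, as every
  -- function is then constant.
  rcases Nat.eq_zero_or_pos m with rfl | hm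
  · refine eLpNorm_le_ofReal_of_abs_le _ fun ω => ?_
    have h0 := oscLe_zero_of_dobrushin_pow_zero ((hb (U 0 ω)).trans_lt hb1) hf
      (OscLe.of_bound hfC)
    exact (h0.abs_diffInt_le _ _ hf).trans (by positivity)
  -- The martingale estimate needs a positive bound on the increments, hence `C > 0`.
  rcases hC.eq_or_lt with rfl | hC
  · refine eLpNorm_le_ofReal_of_abs_le _ fun ω => ?_
    simpa using abs_diffInt_le_two (occupation (fun p => Y p ω) n : Measure E)
      (average (fun p => π (U p ω)) n) hfC
  have hsplit : (fun ω => diffInt (occupation (fun p => Y p ω) n : Measure E)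
      (average (fun p => π (U p ω)) n) f) = ((n : ℝ) + 1)⁻¹ • fun ω =>
        ∑ p ∈ Finset.range (n + 1), (f (Y p ω) - ∫ x, f x ∂(π (U p ω) : Measure E)) := by
    funext ω
    simp only [Pi.smul_apply, smul_eq_mul, diffInt]
    rw [integral_occupation _ n hf hfC, integral_average _ n hf hfC, ← mul_sub,
      Finset.sum_sub_distrib]
  have hn : (0 : ℝ) < n + 1 := by positivity
  rw [hsplit, eLpNorm_const_smul, Real.enorm_of_nonneg (by positivity)]
  refine (mul_le_mul_right (eLpNorm_sum_sub_integral_le 𝒢 h𝒢 K hU hY hπ hm hb hb0 hb1 hc hKU hf hC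
    hfC hr n) _).trans ?_
  rw [← ENNReal.ofReal_mul (by positivity)]
  refine ENNReal.ofReal_le_ofReal ?_
  have hs : √((n : ℝ) + 1) * √((n : ℝ) + 1) = n + 1 := Real.mul_self_sqrt hn.le
  have hs0 : 0 < √((n : ℝ) + 1) := Real.sqrt_pos.2 hn
  have hi : ((n : ℝ) + 1)⁻¹ = (√((n : ℝ) + 1))⁻¹ * (√((n : ℝ) + 1))⁻¹ := by
    rw [← mul_inv, hs]
  calc _ ≤ ((n : ℝ) + 1)⁻¹ * (16 * r * C * A * √((n : ℝ) + 1)) := by gcongr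
    _ = _ := by
      rw [hi]
      field_simp

variable [mΩ : MeasurableSpace Ω] {S : ℕ → Type u} [mS : ∀ l, MeasurableSpace (S l)] {𝓜 : Model S}
  {P : Measure Ω} {X : ∀ l, ℕ → Ω → S l}

lemma IsIMCMC.measurable (hX : IsIMCMC 𝓜 P X) : ∀ l n, Measurable (X l n)
  | 0, n => hX.base.measurable n
  | l + 1, n => (hX.step l).measurable n

variable [IsProbabilityMeasure P]

lemma IsIMCMC.flowClose_zero (hX : IsIMCMC 𝓜 P X) {n₀ : ℕ} (hb : 𝓜.b 0 n₀ < 1) {c : ℝ}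
    (hc : 0 ≤ c) {r : ℝ} (hr : 1 ≤ r) {A : ℝ}
    (hA : (1 + c) * (n₀ / (1 - 𝓜.b 0 n₀)) ^ 2 ≤ A) :
    FlowClose P r (fun ω => occupation fun p => X 0 p ω) (fun _ _ => 𝓜.target 0) (16 * r * A) := by
  have hM := 𝓜.markov₀
  -- Level `0` is the case of a one-point parameter space, where the drift is zero and any `c ≥ 0`
  -- is allowed.
  have h := flowClose_occupation (α := Unit) ⊥ bot_le (𝓜.M₀.prodMkLeft Unit)
    (U := fun _ _ => ()) (fun _ => measurable_const) hX.base (π := fun _ => 𝓜.π₀)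
    (fun _ => 𝓜.invariant₀) (m := n₀) (b := 𝓜.b 0 n₀) (fun _ => le_rfl) (dobrushin_nonneg _) hb
    hc (fun n ω x => by
      refine (tvDist_le_of_forall (C := 0) fun f _ _ => ?_).trans (by positivity)
      simp [diffInt]) hr hA
  simp only [average_const] at h
  exact h

lemma Model.dobrushin_le_b (𝓜 : Model S) (l n : ℕ) (μ : ProbabilityMeasure (S l)) :
    dobrushin ((𝓜.M l).sectR μ ^ n) ≤ 𝓜.b (l + 1) n := by
  have hM := 𝓜.markov l
  exact le_ciSup (f := fun μ => dobrushin ((𝓜.M l).sectR μ ^ n))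
    ⟨1, Set.forall_mem_range.2 fun μ => dobrushin_le_one _⟩ μ

/-- Measurability of `Φ` is not part of the model. It follows from the measurability of the
transitions, since mixing determines their invariant measures as limits of iterates. -/
lemma Model.measurable_Φ (𝓜 : Model S) {l n : ℕ} (hb : 𝓜.b (l + 1) n < 1) :
    Measurable (𝓜.Φ l) := by
  have hM := 𝓜.markov l
  have hE : Nonempty (S (l + 1)) :=
    nonempty_of_isProbabilityMeasure (𝓜.ν (l + 1) : Measure (S (l + 1)))
  obtain ⟨m, hm, b, hb1, hb⟩ := exists_mixing (𝓜.dobrushin_le_b l n) hb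
  exact measurable_of_invariant (𝓜.M l) (𝓜.invariant l) hm hb hb1

lemma IsIMCMC.flowClose_succ (hX : IsIMCMC 𝓜 P X) {c : ℕ → ℝ≥0} {n₀ : ℕ → ℕ}
    (hM : 𝓜.Regular c n₀) {r : ℝ} (hr : 1 ≤ r) (l : ℕ) {A : ℝ}
    (hA : (1 + c (l + 1)) * (n₀ (l + 1) / (1 - 𝓜.b (l + 1) (n₀ (l + 1)))) ^ 2 ≤ A) :
    FlowClose P r (fun ω => occupation fun p => X (l + 1) p ω)
      (fun ω => 𝓜.Φbar l (occupation fun p => X l p ω)) (16 * r * A) := by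
  have hMk := 𝓜.markov l
  refine flowClose_occupation (⨆ p, (mS l).comap (X l p))
    (iSup_le fun p => (hX.measurable l p).comap_le) (𝓜.M l)
    (U := fun n ω => occupation (fun p => X l p ω) n) (fun n => ?_) (hX.step l)
    (𝓜.invariant l) (𝓜.dobrushin_le_b l _)
    (Real.iSup_nonneg fun _ => dobrushin_nonneg _) (hM.2 (l + 1)) (NNReal.coe_nonneg (c (l + 1)))
    (fun n ω x => ?_) hr hA
  · exact @measurable_occupation Ω (⨆ p, (mS l).comap (X l p)) _ _ _
      (fun p => measurable_iff_comap_le.2 (le_iSup (fun p => (mS l).comap (X l p)) p)) n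
  · have h1 := hM.1 l (occupation (fun p => X l p ω) (n + 1)) (occupation (fun p => X l p ω) n)
    -- A real supremum is informative only over a bounded family; here `2` bounds all total
    -- variation distances.
    have h2 := le_ciSup (f := fun x => tvDist
        ((𝓜.M l).sectR (occupation (fun p => X l p ω) (n + 1)) x)
        ((𝓜.M l).sectR (occupation (fun p => X l p ω) n) x))
      ⟨2, Set.forall_mem_range.2 fun x => tvDist_le_two _ _⟩ x
    exact (h2.trans h1).trans (mul_le_mul_of_nonneg_left
      (tvDist_occupation_succ_le _ n) (NNReal.coe_nonneg _))

end Levels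

/-! ### Accumulation of local errors over several levels -/

section Semigroup

variable {Ω : Type v} [mΩ : MeasurableSpace Ω] {S : ℕ → Type u} [mS : ∀ l, MeasurableSpace (S l)]
  {𝓜 : Model S} {P : Measure Ω} [IsProbabilityMeasure P] {X : ∀ l, ℕ → Ω → S l}

lemma semigroup_const (𝓜 : Model S) (l k : ℕ) :
    𝓜.semigroup l k (fun _ => 𝓜.target l) = fun _ => 𝓜.target (l + k) := by
  induction k with
  | zero => rfl
  | succ k ih =>
    change average (fun p => 𝓜.Φ (l + k) (𝓜.semigroup l k (fun _ => 𝓜.target l) p)) = _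
    rw [ih]
    exact average_const _

lemma measurable_semigroup (hΦ : ∀ l, Measurable (𝓜.Φ l)) (l k : ℕ)
    {η : Ω → ℕ → ProbabilityMeasure (S l)} (hη : ∀ n, Measurable fun ω => η ω n) (n : ℕ) :
    Measurable fun ω => 𝓜.semigroup l k (η ω) n := by
  induction k generalizing n with
  | zero => exact hη n
  | succ k ih => exact measurable_Φbar (hΦ (l + k)) ih n

variable {Γ : ∀ l, BddMeas (S (l + 1)) → FunMeasure.{u, w} (S l)} {Λ : ℕ → ℝ≥0} {r D B : ℝ}

/-- One more level multiplies the previous error by at most `B` and adds a local error `D`, which is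
the recursion of the geometric sum. It serves both inductions below. -/
lemma FlowClose.succ (hr : 1 ≤ r) (hΦ : ∀ l, Measurable (𝓜.Φ l)) (hW : 𝓜.WeakLipschitz Γ Λ)
    (hD : 0 ≤ D) (hB : ∀ l, 2 * (Λ (l + 1) : ℝ) ≤ B) {l : ℕ}
    {η' : Ω → ℕ → ProbabilityMeasure (S (l + 1))} {η μ : Ω → ℕ → ProbabilityMeasure (S l)}
    (hη' : ∀ n, Measurable fun ω => η' ω n) (hη : ∀ n, Measurable fun ω => η ω n)
    (hμ : ∀ n, Measurable fun ω => μ ω n)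
    (h' : FlowClose P r η' (fun ω => 𝓜.Φbar l (η ω)) D) {k : ℕ}
    (h : FlowClose P r η μ (D * ∑ j ∈ Finset.range k, B ^ j)) :
    FlowClose P r η' (fun ω => 𝓜.Φbar l (μ ω)) (D * ∑ j ∈ Finset.range (k + 1), B ^ j) := by
  have hB0 : 0 ≤ B := le_trans (by positivity) (hB 0)
  have hG : 0 ≤ D * ∑ j ∈ Finset.range k, B ^ j :=
    mul_nonneg hD (Finset.sum_nonneg fun j _ => pow_nonneg hB0 j)
  refine (FlowClose.trans hr hη' (measurable_Φbar (hΦ l) hη) (measurable_Φbar (hΦ l) hμ) hD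
    (by positivity) h' (h.Φbar hr (hΦ l) hη hμ hW hG)).mono ?_
  rw [geom_sum_succ]
  have := mul_le_mul_of_nonneg_right (hB l) hG
  linarith

lemma flowClose_semigroup (hX : IsIMCMC 𝓜 P X) (hr : 1 ≤ r) (hΦ : ∀ l, Measurable (𝓜.Φ l))
    (hW : 𝓜.WeakLipschitz Γ Λ) (hD : 0 ≤ D) (hB : ∀ l, 2 * (Λ (l + 1) : ℝ) ≤ B)
    (hstep : ∀ l, FlowClose P r (fun ω => occupation fun p => X (l + 1) p ω)
      (fun ω => 𝓜.Φbar l (occupation fun p => X l p ω)) D)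
    (l k : ℕ) :
    FlowClose P r (fun ω => occupation fun p => X (l + k) p ω)
      (fun ω => 𝓜.semigroup l k (occupation fun p => X l p ω))
      (D * ∑ j ∈ Finset.range k, B ^ j) := by
  induction k with
  | zero =>
    intro n f hf C hC hfC
    exact eLpNorm_le_ofReal_of_abs_le _ fun ω => by simp [diffInt, Model.semigroup]
  | succ k ih =>
    exact FlowClose.succ hr hΦ hW hD hB (measurable_occupation (hX.measurable (l + k + 1)))
      (measurable_occupation (hX.measurable (l + k)))
      (measurable_semigroup hΦ l k (measurable_occupation (hX.measurable l))) (hstep (l + k)) ih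

/-- No stability is involved: this handles the low levels, which do not have enough levels below
them. The sum has `l + 1` terms because level `0` contributes a local error too. -/
lemma flowClose_target (hX : IsIMCMC 𝓜 P X) (hr : 1 ≤ r) (hΦ : ∀ l, Measurable (𝓜.Φ l))
    (hW : 𝓜.WeakLipschitz Γ Λ) (hD : 0 ≤ D) (hB : ∀ l, 2 * (Λ (l + 1) : ℝ) ≤ B)
    (hstep : ∀ l, FlowClose P r (fun ω => occupation fun p => X (l + 1) p ω)
      (fun ω => 𝓜.Φbar l (occupation fun p => X l p ω)) D)
    (hbase : FlowClose P r (fun ω => occupation fun p => X 0 p ω)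
      (fun _ _ => 𝓜.target 0) D) (l : ℕ) :
    FlowClose P r (fun ω => occupation fun p => X l p ω) (fun _ _ => 𝓜.target l)
      (D * ∑ j ∈ Finset.range (l + 1), B ^ j) := by
  induction l with
  | zero => simpa using hbase
  | succ l ih =>
    have := FlowClose.succ hr hΦ hW hD hB (measurable_occupation (hX.measurable (l + 1)))
      (measurable_occupation (hX.measurable l)) (fun n => measurable_const) (hstep l) ih
    have h2 : 𝓜.Φbar l (fun _ => 𝓜.target l) = fun _ => 𝓜.target (l + 1) := average_const _
    rwa [h2] at this

end Semigroup

/-! ### The error bound for a given number of levels -/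

section Estimates

variable {Ω : Type v} [mΩ : MeasurableSpace Ω] {S : ℕ → Type u} [mS : ∀ l, MeasurableSpace (S l)]
  {𝓜 : Model S} {P : Measure Ω} [IsProbabilityMeasure P] {X : ∀ l, ℕ → Ω → S l}

lemma Osc1.exists_centered {E : Type u} [MeasurableSpace E] [Nonempty E] (f : Osc1 E) :
    ∃ g : E → ℝ, Measurable g ∧ (∀ x, |g x| ≤ 1) ∧ ∀ μ ν : ProbabilityMeasure E,
      diffInt (μ : Measure E) ν f.1 = diffInt (μ : Measure E) ν g := by
  obtain ⟨x₀⟩ := ‹Nonempty E›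
  exact ⟨fun x => f.1 x - f.1 x₀, f.2.1.sub_const _, fun x => f.2.2 x x₀, fun μ ν =>
    (diffInt_sub_const (μ : Measure E) ν f.2.1 (D := 1) f.2.2 _).symm⟩

lemma lrError_le (hX : IsIMCMC 𝓜 P X) {r : ℝ} (hr : 1 ≤ r) (l n : ℕ) (f : Osc1 (S l)) {C : ℝ}
    (hC : 0 ≤ C) (h : eLpNorm (fun ω => diffInt (occupation (fun p => X l p ω) n : Measure (S l))
      (𝓜.target l) f.1) (ENNReal.ofReal r) P ≤ ENNReal.ofReal C) :
    lrError 𝓜 P X r l n f.1 ≤ C := by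
  have hr0 : 0 < r := by linarith
  have hL : MemLp (fun ω => diffInt (occupation (fun p => X l p ω) n : Measure (S l))
      (𝓜.target l) f.1) (ENNReal.ofReal r) P :=
    MemLp.of_bound (measurable_diffInt (measurable_occupation (hX.measurable l) n)
      measurable_const f.2.1).aestronglyMeasurable 1
      (Filter.Eventually.of_forall fun ω => OscLe.abs_diffInt_le _ _ f.2.1 f.2.2)
  rw [hL.eLpNorm_eq_integral_rpow_norm (by simpa using hr0) ENNReal.ofReal_ne_top,
    ENNReal.toReal_ofReal hr0.le, ENNReal.ofReal_le_ofReal_iff hC] at h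
  rw [lrError, one_div]
  exact h

lemma tvDist_le_flowDist {E : Type u} [MeasurableSpace E] (η μ : ℕ → ProbabilityMeasure E)
    (n : ℕ) : tvDist (η n : Measure E) (μ n) ≤ flowDist η μ :=
  le_ciSup (f := fun n => tvDist (η n : Measure E) (μ n))
    ⟨2, Set.forall_mem_range.2 fun _ => tvDist_le_two _ _⟩ n

/-- The `𝕃_r` error is controlled by `k` local errors and the contraction of the semigroup over
`k` levels. -/
lemma lrError_le_of_stable (hX : IsIMCMC 𝓜 P X)
    {Γ : ∀ l, BddMeas (S (l + 1)) → FunMeasure.{u, w} (S l)} {Λ c : ℕ → ℝ≥0} {n₀ : ℕ → ℕ}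
    (hW : 𝓜.WeakLipschitz Γ Λ) (hM : 𝓜.Regular c n₀) {lam₁ lam₂ : ℝ} (h₁ : 0 ≤ lam₁) {k₀ : ℕ}
    (hstable : 𝓜.ExpStable lam₁ lam₂ k₀) {A B : ℝ}
    (hA : ∀ k, (1 + (c k : ℝ)) * ((n₀ k : ℝ) / (1 - 𝓜.b k (n₀ k))) ^ 2 ≤ A)
    (hB : ∀ k, 2 * (Λ (k + 1) : ℝ) ≤ B) {r : ℝ} (hr : 1 ≤ r) {k : ℕ} (hk : k₀ ≤ k) (l n : ℕ)
    (f : Osc1 (S l)) :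
    lrError 𝓜 P X r l n f.1 ≤ 16 * r * A * (∑ j ∈ Finset.range k, B ^ j) / √((n : ℝ) + 1) +
      lam₁ * Real.exp (-lam₂ * k) := by
  have hA0 : 0 ≤ A := le_trans (by positivity) (hA 0)
  have hB0 : 0 ≤ B := le_trans (by positivity) (hB 0)
  have hD : 0 ≤ 16 * r * A := by positivity
  have hG : 0 ≤ ∑ j ∈ Finset.range k, B ^ j := Finset.sum_nonneg fun j _ => pow_nonneg hB0 j
  have hΦ : ∀ l, Measurable (𝓜.Φ l) := fun l => 𝓜.measurable_Φ (hM.2 (l + 1))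
  have hstep := fun l => hX.flowClose_succ hM hr l (hA (l + 1))
  have hE : Nonempty (S l) := nonempty_of_isProbabilityMeasure (𝓜.ν l : Measure (S l))
  obtain ⟨g, hg, hg1, hfg⟩ := Osc1.exists_centered f
  refine lrError_le hX hr l n f (by positivity) ?_
  simp only [hfg]
  rw [ENNReal.ofReal_add (by positivity) (by positivity)]
  -- If `l < k`, the `l + 1 ≤ k` local errors counted from level `0` already suffice. Otherwise the
  -- semigroup is started `k` levels below, at the random flow and at the constant flow of targets.
  rcases lt_or_ge l k with hlk | hkl
  · have h := flowClose_target hX hr hΦ hW hD hB hstep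
      (hX.flowClose_zero (hM.2 0) (NNReal.coe_nonneg (c 0)) hr (hA 0)) l n g hg 1 zero_le_one hg1
    refine (h.trans (ENNReal.ofReal_le_ofReal ?_)).trans (le_add_of_nonneg_right zero_le)
    rw [one_mul]
    gcongr
    exact hlk
  · obtain ⟨i, rfl⟩ := Nat.exists_eq_add_of_le' hkl
    have h := flowClose_semigroup hX hr hΦ hW hD hB hstep i k n g hg 1 zero_le_one hg1
    rw [one_mul] at h
    have hη : ∀ p, Measurable fun ω => occupation (fun p => X i p ω) p :=
      measurable_occupation (hX.measurable i)
    have hm := measurable_semigroup hΦ i k hη n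
    have hsplit : (fun ω => diffInt (occupation (fun p => X (i + k) p ω) n : Measure (S (i + k)))
        (𝓜.target (i + k)) g) =
        (fun ω => diffInt (occupation (fun p => X (i + k) p ω) n : Measure (S (i + k)))
          (𝓜.semigroup i k (occupation fun p => X i p ω) n) g) +
        fun ω => diffInt (𝓜.semigroup i k (occupation fun p => X i p ω) n : Measure (S (i + k)))
          (𝓜.semigroup i k (fun _ => 𝓜.target i) n) g := by
      funext ω
      rw [semigroup_const]
      simp [diffInt]
    rw [hsplit]
    refine (eLpNorm_add_le
      (measurable_diffInt (measurable_occupation (hX.measurable (i + k)) n) hm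
        hg).aestronglyMeasurable
      (measurable_diffInt hm measurable_const hg).aestronglyMeasurable (by simpa using hr)).trans ?_
    -- Stability concerns all deterministic flows, so it applies to the occupation measures for each
    -- `ω`.
    refine add_le_add h (eLpNorm_le_ofReal_of_abs_le _ fun ω => ?_)
    have h2 := abs_diffInt_le_tvDist
      (𝓜.semigroup i k (occupation fun p => X i p ω) n : Measure (S (i + k)))
      (𝓜.semigroup i k (fun _ => 𝓜.target i) n) hg zero_le_one hg1
    rw [one_mul] at h2
    exact (h2.trans (tvDist_le_flowDist _ _ n)).trans (hstable i _ _ k hk)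

end Estimates

/-! ### Choice of the number of levels -/

section Optimization

/-- The choice of the number of levels: `k` close to `x = log(n+1) / (2 (λ₂ + log B))`. -/
lemma exists_levels {a N : ℝ} (ha : 0 < a) {k₀ : ℕ} (hN : Real.exp (2 * a * (k₀ + 1)) ≤ N) :
    ∃ k : ℕ, k₀ ≤ k ∧ (k : ℝ) ≤ Real.log N / (2 * a) ∧ Real.log N / (2 * a) ≤ k + 1 := by
  have hN0 : 0 < N := (Real.exp_pos _).trans_le hN
  have h1 : (k₀ : ℝ) + 1 ≤ Real.log N / (2 * a) := by
    rw [le_div_iff₀ (by positivity), Real.le_log_iff_exp_le hN0]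
    rwa [mul_comm]
  have hx : 0 ≤ Real.log N / (2 * a) := le_trans (by positivity) h1
  refine ⟨⌊Real.log N / (2 * a)⌋₊, ?_, Nat.floor_le hx, (Nat.lt_floor_add_one _).le⟩
  exact Nat.le_floor (by linarith)

lemma rpow_half_eq_sqrt_pow {N : ℝ} (hN : 0 < N) (s : ℝ) :
    N ^ (s / 2) = Real.exp (s * (Real.log N / 2)) := by
  rw [Real.rpow_def_of_pos hN]
  ring_nf

lemma sqrt_eq_exp {N : ℝ} (hN : 0 < N) : √N = Real.exp (Real.log N / 2) := by
  rw [Real.sqrt_eq_rpow, Real.rpow_def_of_pos hN]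
  ring_nf

end Optimization

end IMCMC

end

open IMCMC
theorem mainTheorem4 :
    ∃ e : ℝ → ℝ, ∀ (r : ℝ), 1 ≤ r →
    ∀ (S : ℕ → Type u) [∀ l, MeasurableSpace (S l)] (𝓜 : Model S)
      (Ω : Type v) [MeasurableSpace Ω] (P : Measure Ω) [IsProbabilityMeasure P]
      (X : ∀ l, ℕ → Ω → S l) (_hX : IsIMCMC 𝓜 P X)
      (Γ : ∀ l, BddMeas (S (l + 1)) → FunMeasure.{u, w} (S l))
      (Λ c : ℕ → ℝ≥0) (n₀ : ℕ → ℕ)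
      (_hΦ : 𝓜.WeakLipschitz Γ Λ) (_hM : 𝓜.Regular c n₀)
      (lam₁ lam₂ : ℝ) (_h₁ : 0 < lam₁) (_h₂ : 0 < lam₂) (k₀ : ℕ)
      (_hstable : 𝓜.ExpStable lam₁ lam₂ k₀)
      (A B : ℝ)
      (_hA : IsLUB (Set.range fun k =>
        (1 + (c k : ℝ)) * ((n₀ k : ℝ) / (1 - 𝓜.b k (n₀ k))) ^ 2) A)
      (_hB : IsLUB (Set.range fun k => 2 * (Λ (k + 1) : ℝ)) B),
      (B = 1 → ∀ n : ℕ, Real.exp (2 * lam₂ * (k₀ + 1)) ≤ (n : ℝ) + 1 →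
        ∀ f : ∀ l, Osc1 (S l), ∀ l,
          lrError 𝓜 P X r l n (f l).1 ≤
            e r / Real.sqrt (n + 1) *
              (A * (1 + Real.log (n + 1) / (2 * lam₂)) + lam₁ * Real.exp lam₂)) ∧
      (1 < B → ∀ n : ℕ, Real.exp (2 * (lam₂ + Real.log B) * (k₀ + 1)) ≤ (n : ℝ) + 1 →
        ∀ f : ∀ l, Osc1 (S l), ∀ l,
          lrError 𝓜 P X r l n (f l).1 ≤
            e r * (A * B / (B - 1) + lam₁) *
              (Real.exp lam₂ / ((n : ℝ) + 1) ^ (lam₂ / (lam₂ + Real.log B) / 2))) := by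
  refine ⟨fun r => 16 * r, ?_⟩
  intro r hr S _ 𝓜 Ω _ P _ X hX Γ Λ c n₀ hW hM lam₁ lam₂ h₁ h₂ k₀ hstable A B hA hB
  have hA' : ∀ k, (1 + (c k : ℝ)) * ((n₀ k : ℝ) / (1 - 𝓜.b k (n₀ k))) ^ 2 ≤ A :=
    fun k => hA.1 ⟨k, rfl⟩
  have hB' : ∀ k, 2 * (Λ (k + 1) : ℝ) ≤ B := fun k => hB.1 ⟨k, rfl⟩
  have hA0 : 0 ≤ A := le_trans (by positivity) (hA' 0)
  refine ⟨fun hB1 n hn f l => ?_, fun hB1 n hn f l => ?_⟩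
  · subst hB1
    have hN : (0 : ℝ) < (n : ℝ) + 1 := by positivity
    obtain ⟨k, hk, hkx, hxk⟩ := exists_levels h₂ hn
    refine (lrError_le_of_stable hX hW hM h₁.le hstable hA' hB' hr hk l n (f l)).trans ?_
    simp only [one_pow, Finset.sum_const, Finset.card_range, nsmul_eq_mul, mul_one]
    have hs : 0 < √((n : ℝ) + 1) := Real.sqrt_pos.2 hN
    -- Rounding down loses at most one level, which is the origin of the factor `e^{λ₂}`.
    have h3 : Real.exp (-lam₂ * k) ≤ Real.exp lam₂ / √((n : ℝ) + 1) := by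
      rw [sqrt_eq_exp hN, ← Real.exp_sub, Real.exp_le_exp]
      rw [div_le_iff₀ (by positivity)] at hxk
      linarith
    have h4 : lam₁ * Real.exp (-lam₂ * k) ≤
        16 * r * (lam₁ * (Real.exp lam₂ / √((n : ℝ) + 1))) :=
      -- The stability term carries no constant in `r`; as `16 r ≥ 1`, it fits under the common
      -- factor.
      (mul_le_mul_of_nonneg_left h3 h₁.le).trans
        (le_mul_of_one_le_left (by positivity) (by linarith))
    have h5 : 16 * r * A * k / √((n : ℝ) + 1) ≤
        16 * r * A * (1 + Real.log (n + 1) / (2 * lam₂)) / √((n : ℝ) + 1) := by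
      gcongr
      linarith
    calc _ ≤ _ := add_le_add h5 h4
      _ = _ := by ring
  · have hN : (0 : ℝ) < (n : ℝ) + 1 := by positivity
    have hlog : 0 < Real.log B := Real.log_pos hB1
    set a := lam₂ + Real.log B with ha
    have ha0 : 0 < a := by positivity
    obtain ⟨k, hk, hkx, hxk⟩ := exists_levels ha0 hn
    refine (lrError_le_of_stable hX hW hM h₁.le hstable hA' hB' hr hk l n (f l)).trans ?_
    have hs : 0 < √((n : ℝ) + 1) := Real.sqrt_pos.2 hN
    set s := Real.log ((n : ℝ) + 1) / 2 with hs_def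
    have hx : Real.log ((n : ℝ) + 1) / (2 * a) = s / a := by
      rw [hs_def, div_div]
    rw [hx] at hkx hxk
    rw [rpow_half_eq_sqrt_pow hN, ← Real.exp_sub]
    have hB0 : 0 < B - 1 := by linarith
    have hBk : B ^ k ≤ Real.exp (Real.log B * (s / a)) := by
      rw [← Real.rpow_natCast, Real.rpow_def_of_pos (by linarith), Real.exp_le_exp]
      exact mul_le_mul_of_nonneg_left hkx hlog.le
    have hBs : B ^ k / √((n : ℝ) + 1) ≤ Real.exp (lam₂ - lam₂ / a * s) := by
      rw [sqrt_eq_exp hN, div_le_iff₀ (Real.exp_pos _), ← Real.exp_add]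
      refine hBk.trans (Real.exp_le_exp.2 ?_)
      -- The balance behind the choice of `k`: as `a = λ₂ + log B`, the growth `B^k` leaves of `1 /
      -- √(n+1)` the decay `e^{-λ₂ s / a}`, which is the rate of the stability term.
      have : Real.log B * (s / a) = s - lam₂ / a * s := by
        have : Real.log B = a - lam₂ := by rw [ha]; ring
        rw [this]
        field_simp
      linarith
    have h3 : Real.exp (-lam₂ * k) ≤ Real.exp (lam₂ - lam₂ / a * s) := by
      rw [Real.exp_le_exp]
      have := mul_le_mul_of_nonneg_left hxk h₂.le
      have h4 : lam₂ * (s / a) = lam₂ / a * s := by ring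
      linarith
    have h4 : lam₁ * Real.exp (-lam₂ * k) ≤
        16 * r * (lam₁ * Real.exp (lam₂ - lam₂ / a * s)) :=
      (mul_le_mul_of_nonneg_left h3 h₁.le).trans
        (le_mul_of_one_le_left (by positivity) (by linarith))
    have h5 : ∑ j ∈ Finset.range k, B ^ j ≤ B / (B - 1) * B ^ k := by
      rw [geom_sum_eq hB1.ne', div_mul_eq_mul_div]
      gcongr
      have : 0 < B ^ k := by positivity
      nlinarith
    have h6 : 16 * r * A * (∑ j ∈ Finset.range k, B ^ j) / √((n : ℝ) + 1) ≤
        16 * r * A * (B / (B - 1)) * Real.exp (lam₂ - lam₂ / a * s) := by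
      calc _ ≤ 16 * r * A * (B / (B - 1) * B ^ k) / √((n : ℝ) + 1) := by gcongr
        _ = 16 * r * A * (B / (B - 1)) * (B ^ k / √((n : ℝ) + 1)) := by ring
        _ ≤ _ := mul_le_mul_of_nonneg_left hBs (by positivity)
    calc _ ≤ _ := add_le_add h6 h4
      _ = _ := by ring
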